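/- Let $n\ge 1$ and $1<q\le p<\infty$. Let $\mathcal D_j$ ($j\in\mathbb Z$) be the set of the dyadic cubes $Q=\prod_{\nu=1}^n\left[\frac{m_\nu}{2^j},\frac{m_\nu+1}{2^j}\right)$, $m\in\mathbb Z^n$, and put $\mathcal D=\bigcup_{j}\mathcal D_j$. For $e\in\mathbb Z/2\mathbb Z$ let $h^{e}(t)=\chi_{[0,1)}(2t)+(-1)^{e}\chi_{[1,2)}(2t)$; for $\varepsilon\in E=(\mathbb Z/2\mathbb Z)^n\setminus\{0\}$ and $Q=Q_{jm}\in\mathcal D_j$ let $h^\varepsilon_Q(x)=2^{jn/2}\prod_{i=1}^n h^{\varepsilon_i}(2^jx_i-m_i)$ be the Haar functions. Write $\langle f,\varphi\rangle=\int_{\mathbb R^n} f\varphi\,dx$ and $m_Q(a)=\frac1{|Q|}\int_Q a\,dx$. For $f\in L^{q}_{\rm loc}(\mathbb R^n)$ let $$\|f\|_{\mathcal M^p_q}=\sup_{Q\in\mathcal D}|Q|^{\frac1p-\frac1q}\left(\int_Q|f(y)|^q\,dy\right)^{1/q},$$ and let $\mathcal M^p_q$ be the space of all $f$ for which this is finite.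 For $a\in L^1_{\rm loc}(\mathbb R^n)$ let $$\|a\|_{{\rm BMO}_{\rm dyadic}}=\Big\|\,x\mapsto\sup_{Q\in\mathcal D,\,x\in Q}m_Q\big(|a-m_Q(a)|\big)\Big\|_{L^\infty},$$ and let ${\rm BMO}_{\rm dyadic}$ be the space of all $a$ for which this is finite. Then there is a constant $C$, depending only on $n,p,q$, such that for all $a\in{\rm BMO}_{\rm dyadic}$ and all $f\in\mathcal M^p_q$ the following holds: for every $\varepsilon\in E$ the series $$\sum_{j=-\infty}^\infty\Big(\sum_{Q\in\mathcal D_j}\langle f,\chi_Q\rangle\,\langle a,h^\varepsilon_Q\rangle\,\frac{h^\varepsilon_Q}{|Q|}\Big)$$ converges in $L^{q}_{\rm loc}(\mathbb R^n)$ to a function in $\mathcal M^p_q$, and $$\sum_{\varepsilon\in E}\Big\|\sum_{j=-\infty}^\infty\Big(\sum_{Q\in\mathcal D_j}\langle f,\chi_Q\rangle\,\langle a,h^\varepsilon_Q\rangle\,\frac{h^\varepsilon_Q}{|Q|}\Big)\Big\|_{\mathcal M^p_q}\le C\,\|a\|_{{\rm BMO}_{\rm dyadic}}\,\|f\|_{\mathcal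 M^p_q}.$$ -/

import Mathlib

open MeasureTheory Filter Topology
open scoped ENNReal NNReal

noncomputable section

namespace DyadicMorrey

/-- The dyadic cube `Q_{jm} = ∏ ν, [m_ν / 2^j, (m_ν + 1) / 2^j)` in `ℝⁿ`. -/
def cube {n : ℕ} (j : ℤ) (m : Fin n → ℤ) : Set (Fin n → ℝ) :=
  Set.univ.pi fun i => Set.Ico ((m i : ℝ) / (2 : ℝ) ^ j) (((m i : ℝ) + 1) / (2 : ℝ) ^ j)

/-- The one-dimensional profile `t ↦ χ_{[0,1)}(2t) + (-1)^e χ_{[1,2)}(2t)`. -/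
def haarProfile (e : ZMod 2) (t : ℝ) : ℝ :=
  (Set.Ico (0 : ℝ) 1).indicator (fun _ => (1 : ℝ)) (2 * t)
    + (-1 : ℝ) ^ e.val * (Set.Ico (1 : ℝ) 2).indicator (fun _ => (1 : ℝ)) (2 * t)

/-- The index set `E = (ℤ/2ℤ)ⁿ ∖ {0}`. -/
abbrev HaarIndex (n : ℕ) : Type := {ε : Fin n → ZMod 2 // ε ≠ 0}

/-- The tensor product `h^ε(x) = ∏ i, h^{ε_i}(x_i)`. -/
def haarMother {n : ℕ} (ε : HaarIndex n) (x : Fin n → ℝ) : ℝ :=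
  ∏ i, haarProfile (ε.1 i) (x i)

/-- The Haar function `h^ε_Q(x) = 2^{jn/2} h^ε(2^j x - m)` of the cube `Q = Q_{jm}`. -/
def haar {n : ℕ} (ε : HaarIndex n) (j : ℤ) (m : Fin n → ℤ) (x : Fin n → ℝ) : ℝ :=
  (2 : ℝ) ^ ((j : ℝ) * (n : ℝ) / 2) * haarMother ε (fun i => (2 : ℝ) ^ j * x i - (m i : ℝ))

section Spaces

variable {n : ℕ} {𝕜 : Type*} [RCLike 𝕜]

/-- The Morrey norm `sup_Q |Q|^{1/p - 1/q} (∫_Q |f|^q)^{1/q}`, over all dyadic cubes `Q`,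
as an element of `[0, ∞]`. -/
def morreyNorm (p q : ℝ) (f : (Fin n → ℝ) → 𝕜) : ℝ≥0∞ :=
  ⨆ (j : ℤ) (m : Fin n → ℤ),
    volume (cube j m) ^ (1 / p - 1 / q) * (∫⁻ y in cube j m, ‖f y‖ₑ ^ q) ^ (1 / q)

/-- Membership in the Morrey space `M^p_q` (a finite Morrey norm makes `f` locally `L^q`). -/
def MemMorrey (p q : ℝ) (f : (Fin n → ℝ) → 𝕜) : Prop :=
  AEStronglyMeasurable f volume ∧ morreyNorm p q f < ∞

/-- The dyadic sharp maximal function `sup_{Q ∋ x} m_Q(|a - m_Q(a)|)`. -/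
def sharpMaximal (a : (Fin n → ℝ) → 𝕜) (x : Fin n → ℝ) : ℝ≥0∞ :=
  ⨆ (j : ℤ) (m : Fin n → ℤ) (_ : x ∈ cube j m),
    (volume (cube j m))⁻¹ * ∫⁻ y in cube j m, ‖a y - ⨍ z in cube j m, a z‖ₑ

/-- The dyadic `BMO` norm: the `L^∞` norm of the dyadic sharp maximal function. -/
def bmoNorm (a : (Fin n → ℝ) → 𝕜) : ℝ≥0∞ :=
  essSup (sharpMaximal a) volume

/-- Membership in the dyadic `BMO` space. -/
def MemBMO (a : (Fin n → ℝ) → 𝕜) : Prop :=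
  LocallyIntegrable a volume ∧ bmoNorm a < ∞

/-- The pairing `⟨f, φ⟩ = ∫ f φ` with a real-valued function `φ`. -/
def pairing (f : (Fin n → ℝ) → 𝕜) (φ : (Fin n → ℝ) → ℝ) : 𝕜 :=
  ∫ x, φ x • f x

/-- The `j`-th generation of the paraproduct,
`∑_{Q ∈ D_j} |Q|⁻¹ ⟨f, χ_Q⟩ ⟨a, h^ε_Q⟩ h^ε_Q(x)`.
At each point `x` at most one term of the sum is nonzero. -/
def paraproductLevel (a f : (Fin n → ℝ) → 𝕜) (ε : HaarIndex n) (j : ℤ)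
    (x : Fin n → ℝ) : 𝕜 :=
  ∑' m : Fin n → ℤ,
    (haar ε j m x / volume.real (cube j m)) •
      (pairing f ((cube j m).indicator fun _ => (1 : ℝ)) * pairing a (haar ε j m))

/-- `g` is the sum over all `j ∈ ℤ` of the functions `u j`, the two-sided series converging
in `L^q` on every compact set. -/
def HasSumLqLoc (q : ℝ) (u : ℤ → (Fin n → ℝ) → 𝕜) (g : (Fin n → ℝ) → 𝕜) : Prop :=
  ∀ K : Set (Fin n → ℝ), IsCompact K →
    Tendsto
      (fun N : ℕ × ℕ =>
        eLpNorm (fun x => (∑ j ∈ Finset.Icc (-(N.1 : ℤ)) (N.2 : ℤ), u j x) - g x)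
          (ENNReal.ofReal q) (volume.restrict K))
      atTop (𝓝 0)

end Spaces

end DyadicMorrey

end

/-! On the children of a cube `Q`, one generation of the paraproduct takes the values `± m_Q(f)
β_Q`, where `β_Q` is the normalized Haar coefficient of `a` and the signs over the `2 ^ n` children
sum to zero. Along the tree of dyadic cubes the partial sums therefore form a walk with mean-zero
steps, and the integral of a `q`-th power over `Q` is `|Q|` times an iterated average over children
(`lintegral_haarStep_sum`). The local estimates are proved on abstract trees, by means of functions
whose average over children exceeds their value by a controlled error
(`childMean_pow_le_add_potential`).

Three facts carry them. John–Nirenberg (`potential_variance_le`) bounds the packing sums `|R|⁻¹ ∑_{Q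
⊆ R} |Q| |β_Q|²`. The running maximum `F` of the means of `‖f‖` has its `q`-th moments controlled by
Doob (`exists_doob`); as `F` increases along the tree, packing then bounds the sums of `|Q| |β_Q|²
F_Q ^ q`. Finally, `exists_walk_moment_le` bounds the `q`-th moment of a walk with steps at most
`|β| F` by `η` times the moment of `F` plus a constant times such a sum. This gives an `L^q` bound
for the generations inside a cube (`exists_eLpNorm_sum_unitStep_le`). Since the sums increase to a
finite limit and `η` is arbitrary, it also gives the Cauchy property (`cauchy_sum_unitStep`).

For the Morrey norm on a cube `R`, the series is split at the generation of `R`. The finer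
generations obey the `L^q` bound on `R`. For the coarser ones `|m_Q(f)| ≤ |Q|^{-1/p} ‖f‖`, so they
decay geometrically and uniformly and sum to a multiple of `|R|^{-1/p}`, which the weight `|R|^{1/p
- 1/q}` compensates. Splitting at generation `0` gives convergence. -/

noncomputable section

namespace DyadicMorrey

/-! ### Averaging on trees: Doob's inequality and Carleson's embedding. -/

section Tree

variable {σ τ ι : Type*} [Fintype ι]

/-- The averaging operator over the children of a node of a tree. -/
def childMean (ch : σ → ι → σ) : Module.End ℝ (σ → ℝ) where
  toFun G v := (∑ b, G (ch v b)) / Fintype.card ι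
  map_add' G H := by
    funext v
    simp [Finset.sum_add_distrib, add_div]
  map_smul' c G := by
    funext v
    simp [← Finset.mul_sum, mul_div_assoc]

theorem childMean_apply (ch : σ → ι → σ) (G : σ → ℝ) (v : σ) :
    childMean ch G v = (∑ b, G (ch v b)) / Fintype.card ι := rfl

theorem childMean_mono (ch : σ → ι → σ) {G H : σ → ℝ} (h : G ≤ H) :
    childMean ch G ≤ childMean ch H := fun v => by
  rw [childMean_apply, childMean_apply]
  gcongr with b
  exact h _

theorem childMean_pow_mono (ch : σ → ι → σ) {G H : σ → ℝ} (h : G ≤ H) (d : ℕ) :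
    (childMean ch ^ d) G ≤ (childMean ch ^ d) H := by
  induction d with
  | zero => simpa using h
  | succ d ih =>
    rw [pow_succ', Module.End.mul_apply, Module.End.mul_apply]
    exact childMean_mono ch ih

theorem childMean_pow_nonneg (ch : σ → ι → σ) {G : σ → ℝ} (h : 0 ≤ G) (d : ℕ) :
    0 ≤ (childMean ch ^ d) G := by
  have := childMean_pow_mono ch h d
  rwa [map_zero] at this

theorem childMean_pow_succ_apply (ch : σ → ι → σ) (G : σ → ℝ) (d : ℕ) (v : σ) :
    (childMean ch ^ (d + 1)) G v = (∑ b, (childMean ch ^ d) G (ch v b)) / Fintype.card ι := by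
  rw [pow_succ', Module.End.mul_apply, childMean_apply]

/-- The projection `π` intertwines the two trees. This allows nodes to be enlarged by a memory
(running maximum, position of a walk) which is forgotten again for functions that do not depend on
it. -/
theorem childMean_pow_comp {ch : σ → ι → σ} {ch' : τ → ι → τ} {π : σ → τ}
    (hπ : ∀ v b, π (ch v b) = ch' (π v) b) (G : τ → ℝ) (d : ℕ) (v : σ) :
    (childMean ch ^ d) (fun w => G (π w)) v = (childMean ch' ^ d) G (π v) := by
  induction d generalizing v with
  | zero => simp
  | succ d ih => simp only [childMean_pow_succ_apply, ih, hπ]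

/-- The sums `∑_{k < d} P^k w` of the averaging operator `P`. -/
def potential (ch : σ → ι → σ) (d : ℕ) (w : σ → ℝ) : σ → ℝ :=
  ∑ k ∈ Finset.range d, (childMean ch ^ k) w

theorem potential_zero (ch : σ → ι → σ) (w : σ → ℝ) : potential ch 0 w = 0 := by
  simp [potential]

theorem potential_apply (ch : σ → ι → σ) (d : ℕ) (w : σ → ℝ) (v : σ) :
    potential ch d w v = ∑ k ∈ Finset.range d, (childMean ch ^ k) w v := by
  simp [potential]

theorem potential_succ (ch : σ → ι → σ) (d : ℕ) (w : σ → ℝ) :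
    potential ch (d + 1) w = w + childMean ch (potential ch d w) := by
  rw [potential, Finset.sum_range_succ', potential, map_sum, pow_zero, Module.End.one_apply,
    add_comm]
  simp only [pow_succ', Module.End.mul_apply]

theorem potential_mono (ch : σ → ι → σ) (d : ℕ) {w w' : σ → ℝ} (h : w ≤ w') :
    potential ch d w ≤ potential ch d w' :=
  Finset.sum_le_sum fun k _ => childMean_pow_mono ch h k

theorem potential_comp {ch : σ → ι → σ} {ch' : τ → ι → τ} {π : σ → τ}
    (hπ : ∀ v b, π (ch v b) = ch' (π v) b) (G : τ → ℝ) (d : ℕ) (v : σ) :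
    potential ch d (fun w => G (π w)) v = potential ch' d G (π v) := by
  simp only [potential_apply, childMean_pow_comp hπ]

/-- The Bellman function principle: averaging is monotone, so a one-step bound iterates and the
errors accumulate into a potential. -/
theorem childMean_pow_le_add_potential (ch : σ → ι → σ) {Φ e : σ → ℝ}
    (h : childMean ch Φ ≤ Φ + e) (d : ℕ) :
    (childMean ch ^ d) Φ ≤ Φ + potential ch d e := by
  induction d with
  | zero => simp [potential_zero]
  | succ d ih =>
    rw [pow_succ', Module.End.mul_apply, potential_succ]
    calc childMean ch ((childMean ch ^ d) Φ) ≤ childMean ch (Φ + potential ch d e) :=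
          childMean_mono ch ih
      _ = childMean ch Φ + childMean ch (potential ch d e) := map_add _ _ _
      _ ≤ Φ + e + childMean ch (potential ch d e) := by gcongr
      _ = _ := by rw [add_assoc]

/-- Carleson's embedding for a function that increases along the tree. -/
theorem potential_mul_le (ch : σ → ι → σ) {w φ : σ → ℝ} {K : ℝ} [Nonempty ι]
    (hK : ∀ d v, potential ch d w v ≤ K) (hφ : ∀ v b, φ v ≤ φ (ch v b)) (d : ℕ) (v : σ) :
    potential ch d (fun v => w v * φ v) v
      ≤ φ v * potential ch d w v + K * ((childMean ch ^ d) φ v - φ v) := by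
  induction d generalizing v with
  | zero => simp [potential_zero]
  | succ d ih =>
    have hN : (0 : ℝ) < Fintype.card ι := by exact_mod_cast Fintype.card_pos
    rw [potential_succ, potential_succ, Pi.add_apply, Pi.add_apply, childMean_pow_succ_apply,
      childMean_apply, childMean_apply]
    have key : ∑ b, potential ch d (fun v => w v * φ v) (ch v b) ≤
        ∑ b, (φ v * potential ch d w (ch v b) + K * (childMean ch ^ d) φ (ch v b) - K * φ v) := by
      refine Finset.sum_le_sum fun b _ => (ih _).trans ?_
      -- With `φ` at the child as a free variable, the inductive bound has slope `potential - K ≤ 0`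
      -- in it, so `φ` may be lowered to its value at the parent.
      nlinarith [hφ v b, hK d (ch v b)]
    rw [Finset.sum_sub_distrib, Finset.sum_add_distrib, ← Finset.mul_sum, ← Finset.mul_sum,
      Finset.sum_const, Finset.card_univ, nsmul_eq_mul] at key
    have := div_le_div_of_nonneg_right key hN.le
    refine (add_le_add_right this (w v * φ v)).trans (le_of_eq ?_)
    field_simp
    ring

theorem potential_mul_le' (ch : σ → ι → σ) {w φ : σ → ℝ} {K : ℝ} [Nonempty ι]
    (hK : ∀ d v, potential ch d w v ≤ K) (hφ : ∀ v b, φ v ≤ φ (ch v b)) (h0 : 0 ≤ φ)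
    (d : ℕ) (v : σ) :
    potential ch d (fun v => w v * φ v) v ≤ K * (childMean ch ^ d) φ v := by
  have := potential_mul_le ch hK hφ d v
  nlinarith [mul_le_mul_of_nonneg_left (hK d v) (h0 v)]

/-- The value of the running maximum of `y` at a node that remembers the maximum so far. -/
def runMax (y : σ → ℝ) (v : σ × ℝ) : ℝ := max v.2 (y v.1)

/-- The tree whose nodes remember the running maximum of `y`. -/
def maxTree (ch : σ → ι → σ) (y : σ → ℝ) (v : σ × ℝ) (b : ι) : σ × ℝ := (ch v.1 b, runMax y v)

omit [Fintype ι] in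
theorem runMax_le_runMax (ch : σ → ι → σ) (y : σ → ℝ) (v : σ × ℝ) (b : ι) :
    runMax y v ≤ runMax y (maxTree ch y v b) := le_max_left _ _

theorem le_runMax (y : σ → ℝ) (v : σ × ℝ) : y v.1 ≤ runMax y v := le_max_right _ _

/-- Either `2 c y ≤ F` and half of `F ^ q` suffices, or `F` is bounded by a multiple of `y`. -/
theorem mul_rpow_le_half_add {c q : ℝ} (hq : 1 < q) (hc : 0 < c) :
    ∃ C : ℝ, 0 < C ∧ ∀ F y : ℝ, 0 ≤ F → 0 ≤ y →
      c * (F ^ (q - 1) * y) ≤ (1 / 2) * F ^ q + C * y ^ q := by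
  refine ⟨c * (2 * c) ^ (q - 1), by positivity, fun F y hF hy => ?_⟩
  have e : ∀ t : ℝ, 0 ≤ t → t ^ q = t ^ (q - 1) * t := fun t ht => by
    rw [← Real.rpow_add_one' ht (by linarith)]; congr 1; ring
  have h1 : 0 ≤ F ^ (q - 1) := by positivity
  have h2 : 0 ≤ y ^ (q - 1) := by positivity
  by_cases h : 2 * c * y ≤ F
  · rw [e F hF]
    have : 0 ≤ c * (2 * c) ^ (q - 1) * y ^ q := by positivity
    nlinarith [mul_le_mul_of_nonneg_left h h1]
  · push Not at h
    have : F ^ (q - 1) ≤ (2 * c) ^ (q - 1) * y ^ (q - 1) := by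
      rw [← Real.mul_rpow (by positivity) hy]
      exact Real.rpow_le_rpow hF h.le (by linarith)
    rw [e y hy]
    have h3 := mul_le_mul_of_nonneg_left (mul_le_mul_of_nonneg_right this hy) hc.le
    have : 0 ≤ F ^ q := by positivity
    nlinarith

/-- The derivative in `F` of the right side is `q F ^ (q - 2) (F - G)`, negative below `G`; the
proof uses Young's inequality instead. It covers a jump of the running maximum from `F` to a new
value `G`. -/
theorem rpow_sub_mul_anti {q F G : ℝ} (hq : 1 < q) (hF : 0 ≤ F) (hFG : F ≤ G) :
    G ^ q - q / (q - 1) * (G ^ (q - 1) * G) ≤ F ^ q - q / (q - 1) * (F ^ (q - 1) * G) := by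
  have e : ∀ t : ℝ, 0 ≤ t → t ^ q = t ^ (q - 1) * t := fun t ht => by
    rw [← Real.rpow_add_one' ht (by linarith)]; congr 1; ring
  have hG : 0 ≤ G := hF.trans hFG
  rw [← e G hG]
  have hq' : 0 < q - 1 := by linarith
  have young : q * (F ^ (q - 1) * G) ≤ (q - 1) * F ^ q + G ^ q := by
    have hpq : (q / (q - 1)).HolderConjugate q :=
      (Real.HolderConjugate.conjExponent hq).symm
    have := Real.young_inequality_of_nonneg (a := F ^ (q - 1)) (b := G) (by positivity) hG hpq
    rw [← Real.rpow_mul hF, show (q - 1) * (q / (q - 1)) = q by field_simp] at this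
    field_simp at this
    linarith
  have : q / (q - 1) * (F ^ (q - 1) * G) ≤ F ^ q + G ^ q / (q - 1) := by
    rw [div_mul_eq_mul_div, div_le_iff₀ hq', add_mul, div_mul_cancel₀ _ hq'.ne']
    linarith
  have h2 : q / (q - 1) * G ^ q = G ^ q + G ^ q / (q - 1) := by field_simp; ring
  linarith

/-- This function is the Bellman function of Doob's inequality. Updating the maximum only lowers it;
with the maximum frozen it is affine and decreasing in `y`, which is a submartingale. -/
theorem childMean_doob_le (ch : σ → ι → σ) {y : σ → ℝ} {q : ℝ} [Nonempty ι] (hq : 1 < q)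
    (hy : 0 ≤ y) (hsub : y ≤ childMean ch y) :
    childMean (maxTree ch y)
      (fun v => runMax y v ^ q - q / (q - 1) * (runMax y v ^ (q - 1) * y v.1)) ≤
      (fun v => runMax y v ^ q - q / (q - 1) * (runMax y v ^ (q - 1) * y v.1)) := by
  intro v
  have hN : (0 : ℝ) < Fintype.card ι := by exact_mod_cast Fintype.card_pos
  have hF : 0 ≤ runMax y v := (hy v.1).trans (le_runMax y v)
  set F := runMax y v with hFdef
  have hq' : 0 ≤ q / (q - 1) := div_nonneg (by linarith) (by linarith)
  have key : ∀ b, runMax y (maxTree ch y v b) ^ q - q / (q - 1) *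
      (runMax y (maxTree ch y v b) ^ (q - 1) * y (maxTree ch y v b).1) ≤
      F ^ q - q / (q - 1) * (F ^ (q - 1) * y (ch v.1 b)) := by
    intro b
    have : runMax y (maxTree ch y v b) = max F (y (ch v.1 b)) := rfl
    rw [this]
    rcases le_total (y (ch v.1 b)) F with h | h
    · rw [max_eq_left h]; rfl
    · rw [max_eq_right h]
      exact rpow_sub_mul_anti hq hF h
  rw [childMean_apply, div_le_iff₀ hN]
  refine (Finset.sum_le_sum fun b _ => key b).trans ?_
  rw [Finset.sum_sub_distrib, ← Finset.mul_sum, ← Finset.mul_sum, Finset.sum_const,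
    Finset.card_univ, nsmul_eq_mul]
  have h1 : y v.1 * Fintype.card ι ≤ ∑ b, y (ch v.1 b) := by
    have := hsub v.1
    rwa [childMean_apply, le_div_iff₀ hN] at this
  have h2 : 0 ≤ F ^ (q - 1) := by positivity
  have := mul_le_mul_of_nonneg_left (mul_le_mul_of_nonneg_left h1 h2) hq'
  nlinarith

/-- Doob's maximal inequality on a tree. -/
theorem exists_doob {q : ℝ} (hq : 1 < q) :
    ∃ C : ℝ, 0 < C ∧ ∀ {σ ι : Type*} [Fintype ι] [Nonempty ι] (ch : σ → ι → σ) (y : σ → ℝ),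
      0 ≤ y → y ≤ childMean ch y → ∀ d v,
      (childMean (maxTree ch y) ^ d) (fun v => runMax y v ^ q) (v, 0) ≤
        C * (childMean ch ^ d) (fun v => y v ^ q) v := by
  obtain ⟨C, hC, h⟩ := mul_rpow_le_half_add hq (c := q / (q - 1))
    (div_pos (by linarith) (by linarith))
  refine ⟨2 * C, by positivity, fun {σ ι} _ _ ch y hy hsub d v => ?_⟩
  set Ψ : σ × ℝ → ℝ :=
    fun v => runMax y v ^ q - q / (q - 1) * (runMax y v ^ (q - 1) * y v.1) with hΨ
  have h1 : (childMean (maxTree ch y) ^ d) Ψ (v, 0) ≤ Ψ (v, 0) := by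
    have := childMean_pow_le_add_potential (maxTree ch y) (Φ := Ψ) (e := 0)
      (by simpa using childMean_doob_le ch hq hy hsub) d (v, 0)
    simpa [potential] using this
  -- The initial memory `0` is harmless because `y ≥ 0`: the maximum starts at `y v`, where `Ψ`
  -- equals `(1 - q / (q - 1)) y ^ q`.
  have h0 : Ψ (v, 0) ≤ 0 := by
    have e : runMax y (v, 0) = y v := max_eq_right (hy v)
    have e2 : y v ^ q = y v ^ (q - 1) * y v := by
      rw [← Real.rpow_add_one' (hy v) (by linarith)]; congr 1; ring
    simp only [hΨ, e]
    rw [← e2, sub_nonpos]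
    refine le_mul_of_one_le_left (Real.rpow_nonneg (hy v) _) ?_
    rw [one_le_div (by linarith)]; linarith
  have h2 : (fun v => runMax y v ^ q) ≤
      (2 : ℝ) • Ψ + (2 * C) • (fun v : σ × ℝ => y v.1 ^ q) := by
    intro v
    have := h (runMax y v) (y v.1) ((hy v.1).trans (le_runMax y v)) (hy v.1)
    simp only [hΨ, Pi.add_apply, Pi.smul_apply, smul_eq_mul]
    linarith
  have h3 := childMean_pow_mono (maxTree ch y) h2 d (v, 0)
  rw [map_add, map_smul, map_smul, Pi.add_apply, Pi.smul_apply, Pi.smul_apply, smul_eq_mul,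
    smul_eq_mul] at h3
  have h4 := childMean_pow_comp (ch := maxTree ch y) (ch' := ch) (π := Prod.fst)
    (fun _ _ => rfl) (fun v => y v ^ q) d (v, 0)
  rw [h4] at h3
  linarith

/-- Carleson's embedding theorem on a tree. -/
theorem exists_carleson {q : ℝ} (hq : 1 < q) :
    ∃ C : ℝ, 0 < C ∧ ∀ {σ ι : Type*} [Fintype ι] [Nonempty ι] (ch : σ → ι → σ) (y w : σ → ℝ)
      (K : ℝ), 0 ≤ y → y ≤ childMean ch y → 0 ≤ w → (∀ d v, potential ch d w v ≤ K) → ∀ d v,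
      potential ch d (fun v => w v * y v ^ q) v ≤
        K * (C * (childMean ch ^ d) (fun v => y v ^ q) v) := by
  obtain ⟨C, hC, h⟩ := exists_doob hq
  refine ⟨C, hC, fun {σ ι} _ _ ch y w K hy hsub hw hK d v => ?_⟩
  have hfst : ∀ (v : σ × ℝ) b, (maxTree ch y v b).1 = ch v.1 b := fun _ _ => rfl
  have hK0 : 0 ≤ K := by simpa [potential_zero] using hK 0 v
  have hpos : ∀ v, 0 ≤ runMax y v := fun v => (hy v.1).trans (le_runMax y v)
  calc potential ch d (fun v => w v * y v ^ q) v
      = potential (maxTree ch y) d (fun v => w v.1 * y v.1 ^ q) (v, 0) :=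
        (potential_comp hfst (fun v => w v * y v ^ q) d (v, 0)).symm
    -- Replacing `y` by its running maximum supplies the monotonicity along the tree that summation
    -- by parts needs; Doob pays for it at the end.
    _ ≤ potential (maxTree ch y) d (fun v => w v.1 * runMax y v ^ q) (v, 0) := by
        refine potential_mono _ d (fun v => ?_) _
        exact mul_le_mul_of_nonneg_left
          (Real.rpow_le_rpow (hy _) (le_runMax y v) (by linarith)) (hw _)
    _ ≤ K * (childMean (maxTree ch y) ^ d) (fun v => runMax y v ^ q) (v, 0) := by
        refine potential_mul_le' (maxTree ch y) (w := fun v => w v.1) (fun d v => ?_) (fun v b => ?_)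
          (fun v => Real.rpow_nonneg (hpos v) _) d (v, 0)
        · rw [potential_comp hfst]; exact hK _ _
        · exact Real.rpow_le_rpow (hpos v) (runMax_le_runMax ch y v b) (by linarith)
    _ ≤ K * (C * (childMean ch ^ d) (fun v => y v ^ q) v) :=
        mul_le_mul_of_nonneg_left (h ch y hy hsub d v) hK0

end Tree

/-! ### The John–Nirenberg inequality on a tree. -/

section JohnNirenberg

variable {σ ι E : Type*} [Fintype ι] [NormedAddCommGroup E] [InnerProductSpace ℝ E]

/-- Pythagoras: the increments of `A` average to zero over the children, so the cross terms vanish.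
-/
theorem childMean_norm_sub_sq [Nonempty ι] (ch : σ → ι → σ) {A : σ → E}
    (hA : ∀ v, ∑ b, A (ch v b) = (Fintype.card ι : ℝ) • A v) (c : E) (v : σ) :
    childMean ch (fun u => ‖A u - c‖ ^ 2) v =
      ‖A v - c‖ ^ 2 + (∑ b, ‖A (ch v b) - A v‖ ^ 2) / Fintype.card ι := by
  have hN : (Fintype.card ι : ℝ) ≠ 0 := by exact_mod_cast Fintype.card_ne_zero
  have h : ∀ b, ‖A (ch v b) - c‖ ^ 2 = ‖A (ch v b) - A v‖ ^ 2 +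
      2 * inner ℝ (A (ch v b) - A v) (A v - c) + ‖A v - c‖ ^ 2 := fun b => by
    rw [← norm_add_sq_real]; congr 2; abel
  rw [childMean_apply]
  simp only [h, Finset.sum_add_distrib, ← Finset.mul_sum, ← sum_inner, Finset.sum_sub_distrib, hA]
  simp only [Finset.sum_const, Finset.card_univ, ← Nat.cast_smul_eq_nsmul ℝ, sub_self,
    inner_zero_left]
  field_simp
  ring

/-- The John–Nirenberg inequality on a tree, in the form of a Carleson packing condition for the
martingale differences `A (ch v b) - A v`. Here `W c v` stands for the mean of `‖a - c‖`. -/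
theorem potential_variance_le [Nonempty ι] (ch : σ → ι → σ) {A : σ → E} {W : E → σ → ℝ} {B : ℝ}
    (hA : ∀ v, ∑ b, A (ch v b) = (Fintype.card ι : ℝ) • A v)
    (hW : ∀ c, childMean ch (W c) = W c) (hAW : ∀ c v, ‖A v - c‖ ≤ W c v)
    (hB : ∀ v, W (A v) v ≤ B) (d : ℕ) (v : σ) :
    potential ch d (fun v => (∑ b, ‖A (ch v b) - A v‖ ^ 2) / Fintype.card ι) v ≤
      (8 + 4 * (Fintype.card ι : ℝ) ^ 2) * B ^ 2 := by
  set N : ℝ := (Fintype.card ι : ℝ) with hNdef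
  have hN : 1 ≤ N := by
    rw [hNdef]; exact_mod_cast Fintype.card_pos (α := ι)
  have hN0 : 0 < N := by linarith
  have hW0 : ∀ c v, 0 ≤ W c v := fun c v => (norm_nonneg _).trans (hAW c v)
  have hB0 : 0 ≤ B := (hW0 _ v).trans (hB v)
  have hWsum : ∀ c v, ∑ b, W c (ch v b) = N * W c v := fun c v => by
    conv_rhs => rw [← hW c]
    rw [childMean_apply, mul_div_cancel₀ _ hN0.ne']
  have hWch : ∀ c v b, W c (ch v b) ≤ N * W c v := fun c v b => by
    rw [← hWsum]
    exact Finset.single_le_sum (f := fun b => W c (ch v b)) (fun b _ => hW0 _ _)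
      (Finset.mem_univ b)
  set δ : σ → ℝ := fun v => (∑ b, ‖A (ch v b) - A v‖ ^ 2) / N with hδ
  have sq_le : ∀ c v, ‖A v - c‖ ^ 2 ≤ W c v ^ 2 := fun c v =>
    pow_le_pow_left₀ (norm_nonneg _) (hAW c v) 2
  -- Stopped nodes: where `W` first exceeds `2 B`, the total `4 N² B² + (8 + 4 N²) B²` equals `(4 +
  -- 4 N²) B · 2 B` and is paid for by `W` itself, as in Chebyshev's inequality.
  have large : ∀ c v t, t ≤ (8 + 4 * N ^ 2) * B ^ 2 → W c v ≤ 2 * N * B → 2 * B < W c v →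
      ‖A v - c‖ ^ 2 + t ≤ 4 * B ^ 2 + (4 + 4 * N ^ 2) * B * W c v := by
    intro c v t ht h1 h2
    have h3 : W c v ^ 2 ≤ (2 * N * B) ^ 2 := pow_le_pow_left₀ (hW0 c v) h1 2
    have h4 : (4 + 4 * N ^ 2) * B * (2 * B) ≤ (4 + 4 * N ^ 2) * B * W c v := by gcongr
    nlinarith [sq_le c v, sq_nonneg B]
  -- Simultaneous induction. The second bound, for an arbitrary centre `c`, passes from children to
  -- parent because `W c` is a martingale; the first follows from it by recentring at `c = A v`,
  -- where `W ≤ B`. The range `2 N B` is what a child can reach from a parent with `W ≤ 2 B`.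
  suffices H : ∀ d, (∀ v, potential ch d δ v ≤ (8 + 4 * N ^ 2) * B ^ 2) ∧
      ∀ c v, W c v ≤ 2 * N * B →
        ‖A v - c‖ ^ 2 + potential ch d δ v ≤ 4 * B ^ 2 + (4 + 4 * N ^ 2) * B * W c v from
    (H d).1 v
  intro d
  induction d with
  | zero =>
    simp only [potential_zero, Pi.zero_apply]
    refine ⟨fun v => by positivity, fun c v h => ?_⟩
    rcases le_or_gt (W c v) (2 * B) with h' | h'
    · have : W c v ^ 2 ≤ (2 * B) ^ 2 := pow_le_pow_left₀ (hW0 c v) h' 2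
      have h5 : 0 ≤ (4 + 4 * N ^ 2) * B * W c v := by have := hW0 c v; positivity
      nlinarith [sq_le c v]
    · exact large c v 0 (by positivity) h h'
  | succ d ih =>
    have step : ∀ c v, W c v ≤ 2 * B →
        ‖A v - c‖ ^ 2 + potential ch (d + 1) δ v ≤
          4 * B ^ 2 + (4 + 4 * N ^ 2) * B * W c v := by
      intro c v h
      have h1 := Finset.sum_le_sum (s := Finset.univ) fun b (_ : b ∈ Finset.univ) =>
        ih.2 c (ch v b) ((hWch c v b).trans (by nlinarith))
      rw [Finset.sum_add_distrib, Finset.sum_add_distrib, Finset.sum_const,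
        Finset.card_univ, nsmul_eq_mul, ← hNdef, ← Finset.mul_sum, hWsum] at h1
      have h2 := childMean_norm_sub_sq ch hA c v
      rw [childMean_apply, ← hNdef, div_eq_iff hN0.ne'] at h2
      rw [potential_succ, Pi.add_apply, childMean_apply, ← hNdef, ← add_assoc]
      rw [h2] at h1
      have h3 := div_le_div_of_nonneg_right h1 hN0.le
      refine le_trans (le_of_eq ?_) (h3.trans (le_of_eq ?_))
      · simp only [hδ]; field_simp
      · field_simp
    have first : ∀ v, potential ch (d + 1) δ v ≤ (8 + 4 * N ^ 2) * B ^ 2 := by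
      intro v
      have h1 := step (A v) v ((hB v).trans (by linarith))
      have h2 : (4 + 4 * N ^ 2) * B * W (A v) v ≤ (4 + 4 * N ^ 2) * B * B := by
        gcongr; exact hB v
      rw [sub_self, norm_zero] at h1
      nlinarith
    refine ⟨first, fun c v h => ?_⟩
    rcases le_or_gt (W c v) (2 * B) with h' | h'
    · exact step c v h'
    · exact large c v _ (first v) h h'

end JohnNirenberg

/-! ### Scalar power inequalities. -/

section Scalar

theorem mul_rpow_sub_one_le {r y : ℝ} (hr : 1 ≤ r) (hy : 0 ≤ y) :
    r * y ^ (r - 1) ≤ (r - 1) * y ^ r + 1 := by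
  rcases hr.eq_or_lt with rfl | hr
  · simp
  · have hr' : 0 < r - 1 := by linarith
    have hpq : (r / (r - 1)).HolderConjugate r := (Real.HolderConjugate.conjExponent hr).symm
    have := Real.young_inequality_of_nonneg (a := y ^ (r - 1)) (b := 1) (by positivity)
      zero_le_one hpq
    rw [← Real.rpow_mul hy, show (r - 1) * (r / (r - 1)) = r by field_simp, Real.one_rpow] at this
    field_simp at this
    linarith

/-- Comparison with an integer power `m ≥ s`: a geometric estimate above `1`, Bernoulli's inequality
below. -/
theorem exists_abs_rpow_sub_one_le (s : ℝ) (hs : 0 ≤ s) :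
    ∃ L : ℝ, 0 ≤ L ∧ ∀ y : ℝ, 0 ≤ y → y ≤ 4 → |y ^ s - 1| ≤ L * |y - 1| := by
  set m : ℕ := ⌈s⌉₊ + 1 with hm
  have hsm : s ≤ (m : ℝ) := (Nat.le_ceil s).trans (by rw [hm]; push_cast; linarith)
  have geo : ∀ k : ℕ, ∀ y : ℝ, 1 ≤ y → y ≤ 4 → y ^ k - 1 ≤ 5 ^ k * (y - 1) := by
    intro k y h1 h4
    induction k with
    | zero => simp; linarith
    | succ k ih =>
      have h5 : (1 : ℝ) ≤ 5 ^ k := one_le_pow₀ (by norm_num)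
      have : y * (y ^ k - 1) ≤ 4 * (5 ^ k * (y - 1)) :=
        mul_le_mul h4 ih (by linarith [one_le_pow₀ h1 (n := k)]) (by norm_num)
      rw [pow_succ, pow_succ]
      nlinarith
  refine ⟨5 ^ m + m, by positivity, fun y hy h4 => ?_⟩
  rcases le_total 1 y with h | h
  · have h1 : 1 ≤ y ^ s := Real.one_le_rpow h hs
    rw [abs_of_nonneg (by linarith), abs_of_nonneg (by linarith)]
    have h2 : y ^ s ≤ y ^ m := by
      rw [← Real.rpow_natCast]; exact Real.rpow_le_rpow_of_exponent_le h hsm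
    have h3 : (0 : ℝ) ≤ m * (y - 1) := mul_nonneg (Nat.cast_nonneg _) (by linarith)
    linarith [geo m y h h4]
  · have h1 : y ^ s ≤ 1 := Real.rpow_le_one hy h hs
    rw [abs_of_nonpos (by linarith), abs_of_nonpos (by linarith)]
    have h2 : y ^ m ≤ y ^ s := by
      rcases hy.eq_or_lt with rfl | hy'
      · rw [zero_pow (by omega)]; exact Real.rpow_nonneg le_rfl _
      · rw [← Real.rpow_natCast]; exact Real.rpow_le_rpow_of_exponent_ge hy' h hsm
    have h3 := one_add_mul_le_pow (show (-2 : ℝ) ≤ y - 1 by linarith) m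
    rw [add_sub_cancel] at h3
    have h5 : (0 : ℝ) ≤ 5 ^ m * (1 - y) := mul_nonneg (by positivity) (by linarith)
    linarith

/-- Convexity gives `y ^ r ≤ 1 + r t y ^ (r - 1)` for `y = 1 + t`, and the Lipschitz bound at `1`
turns `y ^ (r - 1)` into `1` at a quadratic cost. The interval is the range of the relative
increment of `‖x‖²` when `‖y‖ < ‖x‖`. -/
theorem exists_rpow_one_add_le (r : ℝ) (hr : 1 ≤ r) :
    ∃ C : ℝ, 0 ≤ C ∧ ∀ t : ℝ, -1 ≤ t → t ≤ 3 → (1 + t) ^ r ≤ 1 + r * t + C * t ^ 2 := by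
  obtain ⟨L, hL, h⟩ := exists_abs_rpow_sub_one_le (r - 1) (by linarith)
  refine ⟨r * L, by positivity, fun t h1 h3 => ?_⟩
  have hy : 0 ≤ 1 + t := by linarith
  have e : (1 + t) ^ r = (1 + t) ^ (r - 1) * (1 + t) := by
    rw [← Real.rpow_add_one' hy (by linarith)]; congr 1; ring
  have h4 := mul_rpow_sub_one_le hr hy
  have h5 := h (1 + t) hy (by linarith)
  rw [add_sub_cancel_left] at h5
  have h6 : t * ((1 + t) ^ (r - 1) - 1) ≤ L * t ^ 2 := by
    calc t * ((1 + t) ^ (r - 1) - 1) ≤ |t * ((1 + t) ^ (r - 1) - 1)| := le_abs_self _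
      _ = |t| * |(1 + t) ^ (r - 1) - 1| := abs_mul _ _
      _ ≤ |t| * (L * |t|) := by gcongr
      _ = L * t ^ 2 := by rw [← sq_abs t]; ring
  nlinarith

theorem rpow_add_le_tangent {r u δ : ℝ} (hr : 0 ≤ r) (hr1 : r ≤ 1) (hu : 0 < u)
    (h : 0 ≤ u + δ) : (u + δ) ^ r ≤ u ^ r + r * u ^ (r - 1) * δ := by
  have h1 : -1 ≤ δ / u := by rw [le_div_iff₀ hu]; linarith
  have h2 := rpow_one_add_le_one_add_mul_self h1 hr hr1
  have h3 : u + δ = u * (1 + δ / u) := by field_simp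
  rw [h3, Real.mul_rpow hu.le (by linarith), Real.rpow_sub_one hu.ne']
  calc u ^ r * (1 + δ / u) ^ r ≤ u ^ r * (1 + r * (δ / u)) := by gcongr
    _ = _ := by field_simp

end Scalar

/-! ### Moments of walks with mean-zero steps. -/

section Walk

/-- If `‖x‖ ≤ ‖y‖` all terms are of size `‖y‖ ^ q`; otherwise `(‖x + y‖²) ^ (q / 2)` is expanded
around `‖x‖²`. The linear term is kept exact since it cancels in the average over children. -/
theorem exists_norm_add_rpow_le {q : ℝ} (hq : 2 ≤ q) :
    ∃ C : ℝ, 0 < C ∧ ∀ {E : Type*} [NormedAddCommGroup E] [InnerProductSpace ℝ E] (x y : E),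
      ‖x + y‖ ^ q ≤ ‖x‖ ^ q + q * ‖x‖ ^ (q - 2) * inner ℝ x y +
        C * (‖x‖ ^ (q - 2) * ‖y‖ ^ 2 + ‖y‖ ^ q) := by
  obtain ⟨C, hC, h⟩ := exists_rpow_one_add_le (q / 2) (by linarith)
  refine ⟨9 * C + 2 ^ q + q, by positivity, fun {E} _ _ x y => ?_⟩
  have hsq : ∀ t : ℝ, 0 ≤ t → (t ^ 2) ^ (q / 2) = t ^ q := fun t ht => by
    rw [← Real.rpow_natCast, ← Real.rpow_mul ht]; congr 1; push_cast; ring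
  have hsub : ∀ t : ℝ, 0 ≤ t → t ^ q = t ^ (q - 2) * t ^ 2 := fun t ht => by
    rw [← Real.rpow_natCast, ← Real.rpow_add' ht (by push_cast; linarith)]
    congr 1; push_cast; ring
  have hin := abs_le.1 (abs_real_inner_le_norm x y)
  rcases le_or_gt ‖x‖ ‖y‖ with hxy | hxy
  · have h1 : ‖x + y‖ ^ q ≤ 2 ^ q * ‖y‖ ^ q := by
      rw [← Real.mul_rpow (by norm_num) (norm_nonneg _)]
      exact Real.rpow_le_rpow (norm_nonneg _) ((norm_add_le _ _).trans (by linarith))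
        (by linarith)
    have h2 : ‖x‖ ^ (q - 2) * (‖x‖ * ‖y‖) ≤ ‖y‖ ^ q := by
      rw [hsub ‖y‖ (norm_nonneg _)]
      have : ‖x‖ ^ (q - 2) ≤ ‖y‖ ^ (q - 2) :=
        Real.rpow_le_rpow (norm_nonneg _) hxy (by linarith)
      have h' : ‖x‖ * ‖y‖ ≤ ‖y‖ ^ 2 := by nlinarith [norm_nonneg y]
      gcongr
    have h3 : 0 ≤ ‖x‖ ^ (q - 2) := by positivity
    have h4 : -(q * ‖y‖ ^ q) ≤ q * ‖x‖ ^ (q - 2) * inner ℝ x y := by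
      have : -(‖x‖ ^ (q - 2) * (‖x‖ * ‖y‖)) ≤ ‖x‖ ^ (q - 2) * inner ℝ x y := by
        nlinarith [hin.1]
      nlinarith
    have h5 : 0 ≤ ‖x‖ ^ q := by positivity
    have h6 : 0 ≤ (9 * C + 2 ^ q + q) * (‖x‖ ^ (q - 2) * ‖y‖ ^ 2) := by positivity
    have h7 : 0 ≤ 9 * C * ‖y‖ ^ q := by positivity
    nlinarith
  · have hx : 0 < ‖x‖ := (norm_nonneg y).trans_lt hxy
    set t : ℝ := (2 * inner ℝ x y + ‖y‖ ^ 2) / ‖x‖ ^ 2 with ht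
    have hx2 : 0 < ‖x‖ ^ 2 := by positivity
    have hy2 : ‖y‖ ^ 2 ≤ ‖x‖ * ‖y‖ := by nlinarith [norm_nonneg y]
    have e1 : ‖x + y‖ ^ 2 = ‖x‖ ^ 2 * (1 + t) := by
      rw [norm_add_sq_real, ht]; field_simp; ring
    have ht1 : -1 ≤ t := by
      have : 0 ≤ ‖x‖ ^ 2 * (1 + t) := e1 ▸ sq_nonneg _
      nlinarith [nonneg_of_mul_nonneg_right this hx2]
    have ht3 : t ≤ 3 := by
      rw [ht, div_le_iff₀ hx2]; nlinarith [hin.2, norm_nonneg y]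
    have habs : t ^ 2 * ‖x‖ ^ 2 ≤ 9 * ‖y‖ ^ 2 := by
      have h1 : t * ‖x‖ ^ 2 = 2 * inner ℝ x y + ‖y‖ ^ 2 := by rw [ht]; field_simp
      have h2 : |t * ‖x‖ ^ 2| ≤ 3 * (‖x‖ * ‖y‖) := by
        rw [h1, abs_le]; constructor <;> nlinarith [hin.1, hin.2, sq_nonneg ‖y‖]
      have h3 := pow_le_pow_left₀ (abs_nonneg _) h2 2
      rw [sq_abs] at h3
      have : (t ^ 2 * ‖x‖ ^ 2) * ‖x‖ ^ 2 ≤ (9 * ‖y‖ ^ 2) * ‖x‖ ^ 2 := by nlinarith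
      exact le_of_mul_le_mul_right this hx2
    have e2 : ‖x + y‖ ^ q = ‖x‖ ^ q * (1 + t) ^ (q / 2) := by
      rw [← hsq _ (norm_nonneg _), e1, Real.mul_rpow (by positivity) (by linarith),
        hsq _ (norm_nonneg _)]
    have h0 : 0 ≤ ‖x‖ ^ (q - 2) := by positivity
    have h1 : ‖x‖ ^ q * (1 + t) ^ (q / 2) ≤ ‖x‖ ^ q * (1 + q / 2 * t + C * t ^ 2) := by
      gcongr; exact h t ht1 ht3
    have h2 : ‖x‖ ^ q * (q / 2 * t) =
        q * ‖x‖ ^ (q - 2) * inner ℝ x y + q / 2 * (‖x‖ ^ (q - 2) * ‖y‖ ^ 2) := by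
      rw [hsub ‖x‖ (norm_nonneg _), ht]; field_simp
    have h3 : ‖x‖ ^ q * (C * t ^ 2) ≤ C * (‖x‖ ^ (q - 2) * (9 * ‖y‖ ^ 2)) := by
      rw [hsub ‖x‖ (norm_nonneg _)]
      calc _ = C * (‖x‖ ^ (q - 2) * (t ^ 2 * ‖x‖ ^ 2)) := by ring
        _ ≤ _ := by gcongr
    have h4 : 0 ≤ ‖x‖ ^ (q - 2) * ‖y‖ ^ 2 := by positivity
    have h5 : 0 ≤ (9 * C + 2 ^ q + q) * ‖y‖ ^ q := by positivity
    have h6 : 0 ≤ (2 ^ q + q / 2) * (‖x‖ ^ (q - 2) * ‖y‖ ^ 2) := by positivity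
    rw [e2]
    nlinarith

end Walk

section Walk

variable {σ ι E : Type*} [NormedAddCommGroup E] [InnerProductSpace ℝ E]

/-- The tree whose nodes remember the position of the walk with increments `s b • D v`. -/
def walkTree (ch : σ → ι → σ) (s : ι → ℝ) (D : σ → E) (v : σ × E) (b : ι) : σ × E :=
  (ch v.1 b, v.2 + s b • D v.1)

variable [Fintype ι] [Nonempty ι]

omit [Nonempty ι] in
theorem sum_norm_add_smul_sq_le {s : ι → ℝ} (hs : ∑ b, s b = 0) (hs1 : ∀ b, |s b| ≤ 1) (x y : E) :
    ∑ b, (‖x + s b • y‖ ^ 2 - ‖x‖ ^ 2) ≤ Fintype.card ι * ‖y‖ ^ 2 := by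
  have h : ∀ b, ‖x + s b • y‖ ^ 2 - ‖x‖ ^ 2 = s b * (2 * inner ℝ x y) + s b ^ 2 * ‖y‖ ^ 2 := by
    intro b
    rw [norm_add_sq_real, inner_smul_right, norm_smul, mul_pow, Real.norm_eq_abs, sq_abs]; ring
  simp only [h]
  rw [Finset.sum_add_distrib, ← Finset.sum_mul, hs, zero_mul, zero_add, ← Finset.sum_mul]
  gcongr
  calc ∑ b, s b ^ 2 ≤ ∑ _b : ι, (1 : ℝ) := by
        gcongr with b
        rw [sq_le_one_iff_abs_le_one]; exact hs1 b
    _ = _ := by simp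

/-- For `q ≤ 2` the power `q / 2` is concave, so the tangent at `‖x‖² + F²` is an upper bound; its
slope is at most a multiple of `F ^ (q - 2)` because `F²` has been added. -/
theorem sum_rpow_le_of_le_two {q : ℝ} (hq : 1 < q) (hq2 : q ≤ 2) {s : ι → ℝ}
    (hs : ∑ b, s b = 0) (hs1 : ∀ b, |s b| ≤ 1) {x y : E} {α F : ℝ} (hF : 0 ≤ F)
    (hy : ‖y‖ ≤ α * F) :
    (∑ b, (‖x + s b • y‖ ^ 2 + F ^ 2) ^ (q / 2)) / Fintype.card ι ≤
      (‖x‖ ^ 2 + F ^ 2) ^ (q / 2) + α ^ 2 * F ^ q := by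
  have hN : (0 : ℝ) < Fintype.card ι := by exact_mod_cast Fintype.card_pos
  rcases hF.eq_or_lt with rfl | hF
  · have : y = 0 := by simpa using hy
    subst this
    have h0 : (0 : ℝ) ^ q = 0 := Real.zero_rpow (by linarith)
    simp [h0, hN.ne']
  set u := ‖x‖ ^ 2 + F ^ 2 with hu
  have hu0 : 0 < u := by positivity
  have h1 : ∀ b, (‖x + s b • y‖ ^ 2 + F ^ 2) ^ (q / 2) ≤
      u ^ (q / 2) + q / 2 * u ^ (q / 2 - 1) * (‖x + s b • y‖ ^ 2 - ‖x‖ ^ 2) := by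
    intro b
    have e : ‖x + s b • y‖ ^ 2 + F ^ 2 = u + (‖x + s b • y‖ ^ 2 - ‖x‖ ^ 2) := by rw [hu]; ring
    rw [e]
    exact rpow_add_le_tangent (by linarith) (by linarith) hu0 (e ▸ by positivity)
  have h2 := Finset.sum_le_sum (s := Finset.univ) fun b (_ : b ∈ Finset.univ) => h1 b
  rw [Finset.sum_add_distrib, ← Finset.mul_sum, Finset.sum_const, Finset.card_univ,
    nsmul_eq_mul] at h2
  have h3 := sum_norm_add_smul_sq_le hs hs1 x y
  have h4 : u ^ (q / 2 - 1) ≤ (F ^ 2) ^ (q / 2 - 1) :=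
    Real.rpow_le_rpow_of_nonpos (by positivity) (by rw [hu]; nlinarith [sq_nonneg ‖x‖])
      (by linarith)
  have h5 : (F ^ 2) ^ (q / 2 - 1) * F ^ 2 = F ^ q := by
    rw [← Real.rpow_natCast, ← Real.rpow_mul hF.le, ← Real.rpow_add hF]
    congr 1; push_cast; ring
  have h6 : ‖y‖ ^ 2 ≤ α ^ 2 * F ^ 2 := by
    rw [← mul_pow]; exact pow_le_pow_left₀ (norm_nonneg _) hy 2
  have h7 : u ^ (q / 2 - 1) * ‖y‖ ^ 2 ≤ α ^ 2 * F ^ q := by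
    calc _ ≤ (F ^ 2) ^ (q / 2 - 1) * (α ^ 2 * F ^ 2) := by gcongr
      _ = α ^ 2 * ((F ^ 2) ^ (q / 2 - 1) * F ^ 2) := by ring
      _ = _ := by rw [h5]
  have h8 : 0 ≤ u ^ (q / 2 - 1) := by positivity
  rw [div_le_iff₀ hN]
  have h9 : q / 2 * u ^ (q / 2 - 1) * ∑ b, (‖x + s b • y‖ ^ 2 - ‖x‖ ^ 2) ≤
      q / 2 * u ^ (q / 2 - 1) * (Fintype.card ι * ‖y‖ ^ 2) := by gcongr
  have h10 : q / 2 * (u ^ (q / 2 - 1) * ‖y‖ ^ 2) ≤ 1 * (α ^ 2 * F ^ q) := by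
    gcongr; linarith
  nlinarith

theorem exists_sum_rpow_le_of_two_le {q : ℝ} (hq : 2 ≤ q) (K : ℝ) {η : ℝ} (hη : 0 < η) :
    ∃ C : ℝ, 0 < C ∧ ∀ {ι E : Type*} [Fintype ι] [Nonempty ι] [NormedAddCommGroup E]
      [InnerProductSpace ℝ E] (s : ι → ℝ), ∑ b, s b = 0 → (∀ b, |s b| ≤ 1) → ∀ (x y : E) (α F : ℝ),
      0 ≤ F → 0 ≤ α → α ^ 2 ≤ K → ‖y‖ ≤ α * F →
      (∑ b, ‖x + s b • y‖ ^ q) / Fintype.card ι ≤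
        ‖x‖ ^ q + (η * (α ^ 2 * ‖x‖ ^ q) + C * (α ^ 2 * F ^ q)) := by
  obtain ⟨C, hC, h⟩ := exists_norm_add_rpow_le hq
  -- Threshold for the mixed term: if `c F ≤ ‖x‖`, then `C F² ≤ η ‖x‖²`; otherwise `‖x‖` is
  -- controlled by `F`.
  set c : ℝ := √(C / η) with hc
  have hc2 : c ^ 2 = C / η := Real.sq_sqrt (by positivity)
  refine ⟨C * c ^ (q - 2) + C * √K ^ (q - 2) + 1, by positivity, ?_⟩
  intro ι E _ _ _ _ s hs hs1 x y α F hF hα hαK hy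
  have hN : (0 : ℝ) < Fintype.card ι := by exact_mod_cast Fintype.card_pos
  have hsub : ∀ t : ℝ, 0 ≤ t → t ^ q = t ^ (q - 2) * t ^ 2 := fun t ht => by
    rw [← Real.rpow_natCast, ← Real.rpow_add' ht (by push_cast; linarith)]
    congr 1; push_cast; ring
  have h1 : ∀ b, ‖x + s b • y‖ ^ q ≤ ‖x‖ ^ q + s b * (q * ‖x‖ ^ (q - 2) * inner ℝ x y) +
      C * (‖x‖ ^ (q - 2) * ‖y‖ ^ 2 + ‖y‖ ^ q) := by
    intro b
    have h2 := h x (s b • y)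
    rw [inner_smul_right] at h2
    have h3 : ‖s b • y‖ ≤ ‖y‖ := by
      rw [norm_smul]; exact mul_le_of_le_one_left (norm_nonneg _) (hs1 b)
    have h4 : C * (‖x‖ ^ (q - 2) * ‖s b • y‖ ^ 2 + ‖s b • y‖ ^ q) ≤
        C * (‖x‖ ^ (q - 2) * ‖y‖ ^ 2 + ‖y‖ ^ q) := by gcongr
    linarith
  have h2 := Finset.sum_le_sum (s := Finset.univ) fun b (_ : b ∈ Finset.univ) => h1 b
  rw [Finset.sum_add_distrib, Finset.sum_add_distrib, ← Finset.sum_mul, hs, Finset.sum_const,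
    Finset.sum_const, Finset.card_univ, nsmul_eq_mul, nsmul_eq_mul] at h2
  have h3 : ‖x‖ ^ (q - 2) * ‖y‖ ^ 2 ≤ α ^ 2 * (‖x‖ ^ (q - 2) * F ^ 2) := by
    have : ‖y‖ ^ 2 ≤ (α * F) ^ 2 := pow_le_pow_left₀ (norm_nonneg _) hy 2
    calc _ ≤ ‖x‖ ^ (q - 2) * (α * F) ^ 2 := by gcongr
      _ = _ := by ring
  have h4 : ‖y‖ ^ q ≤ α ^ 2 * (√K ^ (q - 2) * F ^ q) := by
    have hα' : α ≤ √K := Real.le_sqrt_of_sq_le hαK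
    calc ‖y‖ ^ q ≤ (α * F) ^ q := Real.rpow_le_rpow (norm_nonneg _) hy (by linarith)
      _ = α ^ (q - 2) * α ^ 2 * F ^ q := by rw [Real.mul_rpow hα hF, hsub α hα]
      _ ≤ √K ^ (q - 2) * α ^ 2 * F ^ q := by
        gcongr
      _ = _ := by ring
  have h5 : C * (‖x‖ ^ (q - 2) * F ^ 2) ≤ η * ‖x‖ ^ q + C * c ^ (q - 2) * F ^ q := by
    rcases le_or_gt (c * F) ‖x‖ with h' | h'
    · have : C * F ^ 2 ≤ η * ‖x‖ ^ 2 := by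
        have h6 := pow_le_pow_left₀ (by positivity) h' 2
        rw [mul_pow, hc2, div_mul_eq_mul_div, div_le_iff₀ hη] at h6
        linarith
      have h7 : 0 ≤ ‖x‖ ^ (q - 2) := by positivity
      have h8 : 0 ≤ C * c ^ (q - 2) * F ^ q := by positivity
      rw [hsub ‖x‖ (norm_nonneg _)]
      nlinarith
    · have h6 : ‖x‖ ^ (q - 2) ≤ c ^ (q - 2) * F ^ (q - 2) := by
        rw [← Real.mul_rpow (by positivity) hF]
        exact Real.rpow_le_rpow (norm_nonneg _) h'.le (by linarith)
      have h7 : 0 ≤ η * ‖x‖ ^ q := by positivity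
      rw [hsub F hF]
      calc _ ≤ C * (c ^ (q - 2) * F ^ (q - 2) * F ^ 2) := by gcongr
        _ ≤ _ := by linarith
  rw [div_le_iff₀ hN]
  refine h2.trans ?_
  have h6 : C * (‖x‖ ^ (q - 2) * ‖y‖ ^ 2 + ‖y‖ ^ q) ≤ η * (α ^ 2 * ‖x‖ ^ q) +
      (C * c ^ (q - 2) + C * √K ^ (q - 2) + 1) * (α ^ 2 * F ^ q) := by
    calc _ ≤ C * (α ^ 2 * (‖x‖ ^ (q - 2) * F ^ 2) + α ^ 2 * (√K ^ (q - 2) * F ^ q)) := by gcongr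
      _ = α ^ 2 * (C * (‖x‖ ^ (q - 2) * F ^ 2)) + C * √K ^ (q - 2) * (α ^ 2 * F ^ q) := by ring
      _ ≤ α ^ 2 * (η * ‖x‖ ^ q + C * c ^ (q - 2) * F ^ q) +
          C * √K ^ (q - 2) * (α ^ 2 * F ^ q) := by gcongr
      _ ≤ _ := by
        have : 0 ≤ α ^ 2 * F ^ q := by positivity
        linarith
  nlinarith

/-- Recovers `x ^ q` from the Bellman function. If `x ≤ η ^ (1 / q) F` the first term suffices;
otherwise `F` is at most a multiple of `x`, and concavity makes the difference comparable to `x ^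
q`. -/
theorem exists_rpow_le_add_mul_sub {q η : ℝ} (hq : 1 < q) (hq2 : q ≤ 2) (hη : 0 < η) :
    ∃ C : ℝ, 0 < C ∧ ∀ x F : ℝ, 0 ≤ x → 0 ≤ F →
      x ^ q ≤ η * F ^ q + C * ((x ^ 2 + F ^ 2) ^ (q / 2) - F ^ q) := by
  set c : ℝ := η ^ (1 / q) with hc
  have hcq : c ^ q = η := by
    rw [hc, ← Real.rpow_mul hη.le, one_div_mul_cancel (by linarith), Real.rpow_one]
  have hc0 : 0 < c := by positivity
  have hsq : ∀ t : ℝ, 0 ≤ t → (t ^ 2) ^ (q / 2) = t ^ q := fun t ht => by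
    rw [← Real.rpow_natCast, ← Real.rpow_mul ht]; congr 1; push_cast; ring
  set κ : ℝ := q / 2 * (1 + (c ^ 2)⁻¹) ^ (q / 2 - 1) with hκ
  have hκ0 : 0 < κ := by positivity
  refine ⟨κ⁻¹, by positivity, fun x F hx hF => ?_⟩
  have hmono : F ^ q ≤ (x ^ 2 + F ^ 2) ^ (q / 2) := by
    rw [← hsq F hF]
    exact Real.rpow_le_rpow (by positivity) (by nlinarith) (by linarith)
  rcases le_or_gt x (c * F) with h | h
  · have : x ^ q ≤ η * F ^ q := by
      rw [← hcq, ← Real.mul_rpow hc0.le hF]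
      exact Real.rpow_le_rpow hx h (by linarith)
    have h2 : 0 ≤ κ⁻¹ * ((x ^ 2 + F ^ 2) ^ (q / 2) - F ^ q) :=
      mul_nonneg (by positivity) (by linarith)
    linarith
  · have hx0 : 0 < x := lt_of_le_of_lt (by positivity) h
    set u := x ^ 2 + F ^ 2 with hu
    have hu0 : 0 < u := by positivity
    have h1 := rpow_add_le_tangent (r := q / 2) (u := u) (δ := -x ^ 2) (by linarith) (by linarith)
      hu0 (by rw [hu]; nlinarith [sq_nonneg F])
    rw [show u + -x ^ 2 = F ^ 2 by rw [hu]; ring, hsq F hF] at h1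
    have hle : u ≤ (1 + (c ^ 2)⁻¹) * x ^ 2 := by
      have : F ^ 2 ≤ (c ^ 2)⁻¹ * x ^ 2 := by
        rw [inv_mul_eq_div, le_div_iff₀ (by positivity)]
        have := pow_le_pow_left₀ (by positivity) h.le 2
        rw [mul_pow] at this; linarith
      rw [hu]; linarith
    have h2 : ((1 + (c ^ 2)⁻¹) * x ^ 2) ^ (q / 2 - 1) ≤ u ^ (q / 2 - 1) :=
      Real.rpow_le_rpow_of_nonpos hu0 hle (by linarith)
    have h3 : ((1 + (c ^ 2)⁻¹) * x ^ 2) ^ (q / 2 - 1) * x ^ 2 =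
        (1 + (c ^ 2)⁻¹) ^ (q / 2 - 1) * x ^ q := by
      rw [Real.mul_rpow (by positivity) (by positivity), mul_assoc]
      congr 1
      rw [← Real.rpow_natCast, ← Real.rpow_mul hx, ← Real.rpow_add hx0]
      congr 1; push_cast; ring
    have h4 : κ * x ^ q ≤ u ^ (q / 2) - F ^ q := by
      have : κ * x ^ q = q / 2 * (((1 + (c ^ 2)⁻¹) * x ^ 2) ^ (q / 2 - 1) * x ^ 2) := by
        rw [h3, hκ]; ring
      rw [this]
      have : q / 2 * (((1 + (c ^ 2)⁻¹) * x ^ 2) ^ (q / 2 - 1) * x ^ 2) ≤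
          q / 2 * (u ^ (q / 2 - 1) * x ^ 2) := by gcongr
      linarith
    have h5 : x ^ q ≤ κ⁻¹ * (u ^ (q / 2) - F ^ q) := by
      rw [inv_mul_eq_div, le_div_iff₀ hκ0]; linarith
    have : 0 ≤ η * F ^ q := by positivity
    linarith

/-- Increments of the concave power `q / 2` shrink as the base point grows, so the growth of `F`
along the tree never raises the Bellman function. -/
theorem rpow_add_sub_anti {q x F G : ℝ} (hq : 0 < q) (hq2 : q ≤ 2) (hF : 0 ≤ F)
    (hFG : F ≤ G) :
    (x ^ 2 + G ^ 2) ^ (q / 2) - G ^ q ≤ (x ^ 2 + F ^ 2) ^ (q / 2) - F ^ q := by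
  have hsq : ∀ t : ℝ, 0 ≤ t → (t ^ 2) ^ (q / 2) = t ^ q := fun t ht => by
    rw [← Real.rpow_natCast, ← Real.rpow_mul ht]; congr 1; push_cast; ring
  rcases hF.eq_or_lt with rfl | hF0
  · rw [← hsq G hFG, zero_pow two_ne_zero, add_zero, Real.zero_rpow hq.ne']
    have := Real.rpow_add_le_add_rpow (sq_nonneg x) (sq_nonneg G)
      (show 0 ≤ q / 2 by linarith) (by linarith)
    linarith
  rw [← hsq F hF, ← hsq G (hF.trans hFG)]
  have hFG2 : F ^ 2 ≤ G ^ 2 := pow_le_pow_left₀ hF hFG 2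
  have hanti : AntitoneOn (fun t : ℝ => (x ^ 2 + t) ^ (q / 2) - t ^ (q / 2)) (Set.Ioi 0) := by
    apply antitoneOn_of_deriv_nonpos (convex_Ioi 0)
    · intro t (ht : 0 < t)
      have : x ^ 2 + t ≠ 0 := by positivity
      exact (ContinuousAt.sub (ContinuousAt.rpow_const (by fun_prop) (Or.inl this))
        (ContinuousAt.rpow_const (by fun_prop) (Or.inl ht.ne'))).continuousWithinAt
    · intro t ht
      rw [interior_Ioi] at ht
      have ht : 0 < t := ht
      have : x ^ 2 + t ≠ 0 := by positivity
      exact (DifferentiableAt.sub (DifferentiableAt.rpow_const (by fun_prop) (Or.inl this))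
        (DifferentiableAt.rpow_const (by fun_prop) (Or.inl ht.ne'))).differentiableWithinAt
    · intro t ht
      rw [interior_Ioi] at ht
      have ht : 0 < t := ht
      have hne : x ^ 2 + t ≠ 0 := by positivity
      have h1 : HasDerivAt (fun t : ℝ => (x ^ 2 + t) ^ (q / 2))
          (1 * (q / 2) * (x ^ 2 + t) ^ (q / 2 - 1)) t :=
        ((hasDerivAt_id t).const_add (x ^ 2)).rpow_const (Or.inl hne)
      have h2 := Real.hasDerivAt_rpow_const (x := t) (p := q / 2) (Or.inl ht.ne')
      have h3 : deriv (fun t : ℝ => (x ^ 2 + t) ^ (q / 2) - t ^ (q / 2)) t = _ := (h1.sub h2).deriv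
      rw [h3, one_mul, ← mul_sub]
      refine mul_nonpos_of_nonneg_of_nonpos (by linarith) (sub_nonpos.2 ?_)
      exact Real.rpow_le_rpow_of_nonpos ht (by nlinarith) (by linarith)
  have hF2 : 0 < F ^ 2 := by positivity
  exact hanti hF2 (hF2.trans_le hFG2) hFG2

omit [Fintype ι] [Nonempty ι] in
theorem walkTree_fst (ch : σ → ι → σ) (s : ι → ℝ) (D : σ → E) (v : σ × E) (b : ι) :
    (walkTree ch s D v b).1 = ch v.1 b := rfl

theorem norm_le_childMean_walkTree (ch : σ → ι → σ) {s : ι → ℝ} (hs : ∑ b, s b = 0) (D : σ → E) :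
    (fun v : σ × E => ‖v.2‖) ≤ childMean (walkTree ch s D) (fun v => ‖v.2‖) := by
  intro v
  have hN : (0 : ℝ) < Fintype.card ι := by exact_mod_cast Fintype.card_pos
  rw [childMean_apply, le_div_iff₀ hN]
  have : ∑ b, (v.2 + s b • D v.1) = (Fintype.card ι : ℝ) • v.2 := by
    rw [Finset.sum_add_distrib, ← Finset.sum_smul, hs, zero_smul, add_zero, Finset.sum_const,
      Finset.card_univ, Nat.cast_smul_eq_nsmul]
  have h2 := norm_sum_le Finset.univ fun b => v.2 + s b • D v.1
  rw [this, norm_smul, Real.norm_natCast] at h2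
  rw [mul_comm]
  exact h2

/-- The `q`-th moment of a walk whose increments are dominated by `α F`, where `F` increases along
the tree and `α ^ 2` satisfies a Carleson packing condition. -/
theorem exists_walk_moment_le {q : ℝ} (hq : 1 < q) {K η : ℝ} (hK : 0 ≤ K) (hη : 0 < η) :
    ∃ C : ℝ, 0 < C ∧ ∀ {σ ι E : Type*} [Fintype ι] [Nonempty ι] [NormedAddCommGroup E]
      [InnerProductSpace ℝ E] (ch : σ → ι → σ) (s : ι → ℝ) (D : σ → E) (α F : σ → ℝ),
      ∑ b, s b = 0 → (∀ b, |s b| ≤ 1) → 0 ≤ α → 0 ≤ F → (∀ v b, F v ≤ F (ch v b)) →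
      (∀ v, ‖D v‖ ≤ α v * F v) → (∀ d v, potential ch d (fun v => α v ^ 2) v ≤ K) → ∀ d v,
      (childMean (walkTree ch s D) ^ d) (fun v => ‖v.2‖ ^ q) (v, 0) ≤
        η * (childMean ch ^ d) (fun v => F v ^ q) v +
          C * potential ch d (fun v => α v ^ 2 * F v ^ q) v := by
  rcases le_total q 2 with hq2 | hq2
  · obtain ⟨C, hC, h⟩ := exists_rpow_le_add_mul_sub hq hq2 hη
    refine ⟨C, hC, ?_⟩
    intro σ ι E _ _ _ _ ch s D α F hs hs1 hα hF hmono hD hαK d v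
    -- Subtracting `F ^ q` makes `Φ` vanish at the start of the walk.
    set Φ : σ × E → ℝ := fun v => (‖v.2‖ ^ 2 + F v.1 ^ 2) ^ (q / 2) - F v.1 ^ q with hΦ
    have hN : (0 : ℝ) < Fintype.card ι := by exact_mod_cast Fintype.card_pos
    have step : childMean (walkTree ch s D) Φ ≤ Φ + fun v => α v.1 ^ 2 * F v.1 ^ q := by
      intro v
      have h1 : ∀ b, Φ (walkTree ch s D v b) ≤
          (‖v.2 + s b • D v.1‖ ^ 2 + F v.1 ^ 2) ^ (q / 2) - F v.1 ^ q := fun b =>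
        rpow_add_sub_anti (by linarith) hq2 (hF v.1) (hmono v.1 b)
      rw [childMean_apply]
      have h2 := Finset.sum_le_sum (s := Finset.univ) fun b (_ : b ∈ Finset.univ) => h1 b
      rw [Finset.sum_sub_distrib _ (fun _ => F v.1 ^ q), Finset.sum_const, Finset.card_univ, nsmul_eq_mul] at h2
      have h3 := div_le_div_of_nonneg_right h2 hN.le
      rw [sub_div, mul_div_cancel_left₀ _ hN.ne'] at h3
      have h4 := sum_rpow_le_of_le_two hq hq2 hs hs1 (x := v.2) (hF v.1) (hD v.1)
      simp only [hΦ, Pi.add_apply] at h3 ⊢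
      linarith
    have h1 := childMean_pow_le_add_potential _ step d (v, 0)
    have h0 : Φ (v, 0) = 0 := by
      simp only [hΦ, norm_zero]
      rw [zero_pow two_ne_zero, zero_add, ← Real.rpow_natCast, ← Real.rpow_mul (hF v)]
      rw [show ((2 : ℕ) : ℝ) * (q / 2) = q by push_cast; ring, sub_self]
    rw [Pi.add_apply, h0, zero_add,
      potential_comp (walkTree_fst ch s D) (fun v => α v ^ 2 * F v ^ q) d (v, 0)] at h1
    have h2 : (fun v : σ × E => ‖v.2‖ ^ q) ≤ η • (fun v : σ × E => F v.1 ^ q) + C • Φ :=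
      fun v => h ‖v.2‖ (F v.1) (norm_nonneg _) (hF _)
    have h3 := childMean_pow_mono (walkTree ch s D) h2 d (v, 0)
    rw [map_add, map_smul, map_smul, Pi.add_apply, Pi.smul_apply, Pi.smul_apply, smul_eq_mul,
      smul_eq_mul, childMean_pow_comp (walkTree_fst ch s D) (fun v => F v ^ q) d (v, 0)] at h3
    have := mul_le_mul_of_nonneg_left h1 hC.le
    exact h3.trans (by gcongr)
  · obtain ⟨C₁, hC₁, hcar⟩ := exists_carleson hq
    obtain ⟨C, hC, h⟩ := exists_sum_rpow_le_of_two_le hq2 K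
      (η := (2 * (K * C₁ + 1))⁻¹) (by positivity)
    -- Chosen so that `θ K C₁ ≤ 1 / 2`: Carleson's embedding, applied to the submartingale `‖v.2‖`,
    -- bounds the term with `‖x‖ ^ q` by half of the moment being estimated, which is then absorbed.
    set θ : ℝ := (2 * (K * C₁ + 1))⁻¹ with hθ
    have hθ0 : 0 < θ := by positivity
    refine ⟨2 * C, by positivity, ?_⟩
    intro σ ι E _ _ _ _ ch s D α F hs hs1 hα hF hmono hD hαK d v
    have step : childMean (walkTree ch s D) (fun v => ‖v.2‖ ^ q) ≤ (fun v => ‖v.2‖ ^ q) +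
        ((θ • fun v => α v.1 ^ 2 * ‖v.2‖ ^ q) + C • fun v => α v.1 ^ 2 * F v.1 ^ q) := by
      intro v
      have := h s hs hs1 v.2 (D v.1) (α v.1) (F v.1) (hF v.1) (hα v.1)
        (by simpa [potential_succ, potential_zero] using hαK 1 v.1) (hD v.1)
      rw [childMean_apply]
      exact this
    have h1 := childMean_pow_le_add_potential _ step d (v, 0)
    have e : potential (walkTree ch s D) d
        ((θ • fun v => α v.1 ^ 2 * ‖v.2‖ ^ q) + C • fun v => α v.1 ^ 2 * F v.1 ^ q) (v, 0) =
        θ * potential (walkTree ch s D) d (fun v => α v.1 ^ 2 * ‖v.2‖ ^ q) (v, 0) +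
        C * potential ch d (fun v => α v ^ 2 * F v ^ q) v := by
      rw [← potential_comp (walkTree_fst ch s D) (fun v => α v ^ 2 * F v ^ q) d (v, 0)]
      simp only [potential_apply, map_add, map_smul, Pi.add_apply, Pi.smul_apply, smul_eq_mul,
        Finset.sum_add_distrib, Finset.mul_sum]
    have h2 := hcar (walkTree ch s D) (fun v => ‖v.2‖) (fun v => α v.1 ^ 2) K
      (fun v => norm_nonneg _) (norm_le_childMean_walkTree ch hs D) (fun v => sq_nonneg _)
      (fun d v => by
        rw [potential_comp (walkTree_fst ch s D) (fun v => α v ^ 2) d v]; exact hαK d v.1) d (v, 0)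
    rw [Pi.add_apply, e] at h1
    set M := (childMean (walkTree ch s D) ^ d) (fun v => ‖v.2‖ ^ q) (v, 0) with hM
    have hM0 : 0 ≤ M := childMean_pow_nonneg _ (fun v => by positivity) d _
    have h3 : θ * potential (walkTree ch s D) d (fun v => α v.1 ^ 2 * ‖v.2‖ ^ q) (v, 0) ≤
        M / 2 := by
      refine (mul_le_mul_of_nonneg_left h2 hθ0.le).trans ?_
      have hp : 0 < 2 * (K * C₁ + 1) := by positivity
      rw [hθ, inv_mul_eq_div, div_le_iff₀ hp]
      nlinarith
    have h4 : ‖((v, 0) : σ × E).2‖ ^ q = 0 := by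
      simp [Real.zero_rpow (show q ≠ 0 by linarith)]
    rw [h4] at h1
    have h5 : 0 ≤ η * (childMean ch ^ d) (fun v => F v ^ q) v :=
      mul_nonneg hη.le (childMean_pow_nonneg _ (fun v => Real.rpow_nonneg (hF v) _) d _)
    linarith

end Walk

/-! ### Dyadic cubes and their children. -/

section Geometry

variable {n : ℕ}

/-- The index `m` of the dyadic cube of generation `j` that contains `x`. -/
def location (j : ℤ) (x : Fin n → ℝ) (i : Fin n) : ℤ := ⌊(2 : ℝ) ^ j * x i⌋

theorem mem_cube_iff {j : ℤ} {m : Fin n → ℤ} {x : Fin n → ℝ} :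
    x ∈ cube j m ↔ location j x = m := by
  have h2 : (0 : ℝ) < 2 ^ j := by positivity
  simp only [cube, Set.mem_univ_pi, Set.mem_Ico, funext_iff, location, Int.floor_eq_iff,
    div_le_iff₀ h2, lt_div_iff₀ h2, mul_comm]

theorem mem_cube_location (j : ℤ) (x : Fin n → ℝ) : x ∈ cube j (location j x) :=
  mem_cube_iff.2 rfl

theorem measurableSet_cube (j : ℤ) (m : Fin n → ℤ) : MeasurableSet (cube j m) :=
  MeasurableSet.univ_pi fun _ => measurableSet_Ico

theorem volume_cube (j : ℤ) (m : Fin n → ℤ) :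
    volume (cube j m) = ENNReal.ofReal (((2 : ℝ) ^ j)⁻¹ ^ n) := by
  rw [cube, Real.volume_pi_Ico]
  have : ∀ i, ((m i : ℝ) + 1) / 2 ^ j - m i / 2 ^ j = ((2 : ℝ) ^ j)⁻¹ := fun i => by ring
  simp only [this, Finset.prod_const, Finset.card_univ, Fintype.card_fin]
  rw [ENNReal.ofReal_pow (by positivity)]

theorem volume_real_cube (j : ℤ) (m : Fin n → ℤ) :
    volume.real (cube j m) = ((2 : ℝ) ^ j)⁻¹ ^ n := by
  rw [Measure.real, volume_cube, ENNReal.toReal_ofReal (by positivity)]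

theorem volume_cube_ne_zero (j : ℤ) (m : Fin n → ℤ) : volume (cube j m) ≠ 0 := by
  rw [volume_cube]; simp; positivity

theorem volume_cube_ne_top (j : ℤ) (m : Fin n → ℤ) : volume (cube j m) ≠ ∞ := by
  rw [volume_cube]; exact ENNReal.ofReal_ne_top

instance (j : ℤ) (m : Fin n → ℤ) : IsFiniteMeasure (volume.restrict (cube j m)) :=
  isFiniteMeasure_restrict.2 (volume_cube_ne_top j m)

theorem volume_real_cube_pos (j : ℤ) (m : Fin n → ℤ) : 0 < volume.real (cube j m) := by
  rw [volume_real_cube]; positivity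

/-- The dyadic cubes `Q_{jm}`, as pairs `(j, m)`. -/
abbrev CubeIndex (n : ℕ) : Type := ℤ × (Fin n → ℤ)

/-- The `2 ^ n` dyadic children of a dyadic cube. -/
def child (v : CubeIndex n) (b : Fin n → Fin 2) : CubeIndex n :=
  (v.1 + 1, fun i => 2 * v.2 i + ((b i : ℕ) : ℤ))

/-- The position of the cube of generation `j + 1` around `x` within that of generation `j`. -/
def digit (j : ℤ) (x : Fin n → ℝ) (i : Fin n) : Fin 2 :=
  if location (j + 1) x i = 2 * location j x i then 0 else 1

theorem location_succ (j : ℤ) (x : Fin n → ℝ) :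
    location (j + 1) x = fun i => 2 * location j x i + ((digit j x i : ℕ) : ℤ) := by
  funext i
  have h : location (j + 1) x i = 2 * location j x i ∨
      location (j + 1) x i = 2 * location j x i + 1 := by
    have e : (2 : ℝ) ^ (j + 1) * x i = 2 * (2 ^ j * x i) := by
      rw [zpow_add_one₀ two_ne_zero]; ring
    have h1 : location j x i ≤ (2 : ℝ) ^ j * x i := Int.floor_le _
    have h2 : (2 : ℝ) ^ j * x i < location j x i + 1 := Int.lt_floor_add_one _
    have h3 : 2 * location j x i ≤ location (j + 1) x i :=
      Int.le_floor.2 (by rw [e]; push_cast; linarith)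
    have h4 : location (j + 1) x i < 2 * location j x i + 2 :=
      Int.floor_lt.2 (by rw [e]; push_cast; linarith)
    omega
  rcases h with h | h
  · simp [digit, h]
  · simp [digit, h]

theorem digit_eq_of_mem {v : CubeIndex n} {b : Fin n → Fin 2} {x : Fin n → ℝ}
    (hx : x ∈ cube (child v b).1 (child v b).2) : location v.1 x = v.2 ∧ digit v.1 x = b := by
  rw [mem_cube_iff] at hx
  have h1 : location (v.1 + 1) x = _ := location_succ v.1 x
  have h2 : ∀ i, 2 * location v.1 x i + ((digit v.1 x i : ℕ) : ℤ) =
      2 * v.2 i + ((b i : ℕ) : ℤ) := fun i => by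
    have := congrFun hx i
    have h3 := congrFun h1 i
    simp only [child] at this
    rw [← this, ← h3]
  constructor
  · funext i
    have := h2 i
    have := (digit v.1 x i).isLt
    have := (b i).isLt
    omega
  · funext i
    have := h2 i
    have := (digit v.1 x i).isLt
    have := (b i).isLt
    apply Fin.ext
    omega

theorem cube_eq_iUnion_child (v : CubeIndex n) :
    cube v.1 v.2 = ⋃ b, cube (child v b).1 (child v b).2 := by
  ext x
  rw [Set.mem_iUnion]
  constructor
  · intro hx
    refine ⟨digit v.1 x, ?_⟩
    rw [mem_cube_iff] at hx ⊢
    simp only [child]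
    rw [location_succ, hx]
  · rintro ⟨b, hx⟩
    exact mem_cube_iff.2 (digit_eq_of_mem hx).1

theorem pairwise_disjoint_child (v : CubeIndex n) :
    Pairwise (Function.onFun Disjoint fun b => cube (child v b).1 (child v b).2) := by
  intro b b' hb
  rw [Function.onFun, Set.disjoint_left]
  intro x hx hx'
  exact hb ((digit_eq_of_mem hx).2.symm.trans (digit_eq_of_mem hx').2)

theorem card_children : (Fintype.card (Fin n → Fin 2) : ℝ) = 2 ^ n := by simp

theorem volume_real_child (v : CubeIndex n) (b : Fin n → Fin 2) :
    volume.real (cube v.1 v.2) = 2 ^ n * volume.real (cube (child v b).1 (child v b).2) := by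
  rw [volume_real_cube, volume_real_cube, child, ← mul_pow]
  simp only
  rw [zpow_add_one₀ two_ne_zero, mul_inv, mul_comm _ (2 : ℝ)⁻¹,
    mul_inv_cancel_left₀ two_ne_zero]

theorem lintegral_cube_eq_sum (v : CubeIndex n) (g : (Fin n → ℝ) → ℝ≥0∞) :
    ∫⁻ x in cube v.1 v.2, g x = ∑ b, ∫⁻ x in cube (child v b).1 (child v b).2, g x := by
  rw [cube_eq_iUnion_child, lintegral_iUnion (fun _ => measurableSet_cube _ _)
    (pairwise_disjoint_child v), tsum_fintype]

end Geometry

/-! ### Means over dyadic cubes as martingales. -/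

section Average

variable {n : ℕ} {E : Type*} [NormedAddCommGroup E] [NormedSpace ℝ E]

/-- The mean value over a dyadic cube. -/
def cubeMean (g : (Fin n → ℝ) → E) (v : CubeIndex n) : E := ⨍ x in cube v.1 v.2, g x

theorem smul_cubeMean (g : (Fin n → ℝ) → E) (v : CubeIndex n) :
    volume.real (cube v.1 v.2) • cubeMean g v = ∫ x in cube v.1 v.2, g x := by
  rw [cubeMean, setAverage_eq, smul_inv_smul₀ (volume_real_cube_pos _ _).ne']

theorem integral_cube_eq_sum {g : (Fin n → ℝ) → E} {v : CubeIndex n}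
    (hg : IntegrableOn g (cube v.1 v.2)) :
    ∫ x in cube v.1 v.2, g x = ∑ b, ∫ x in cube (child v b).1 (child v b).2, g x := by
  rw [cube_eq_iUnion_child] at hg ⊢
  exact integral_iUnion_fintype (fun _ => measurableSet_cube _ _) (pairwise_disjoint_child v)
    fun b => hg.mono_set
      (Set.subset_iUnion (fun b => cube (child v b).1 (child v b).2) b)

theorem sum_cubeMean_child {g : (Fin n → ℝ) → E} {v : CubeIndex n}
    (hg : IntegrableOn g (cube v.1 v.2)) :
    ∑ b, cubeMean g (child v b) = (Fintype.card (Fin n → Fin 2) : ℝ) • cubeMean g v := by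
  have h := smul_cubeMean g v
  rw [integral_cube_eq_sum hg] at h
  simp only [← smul_cubeMean] at h
  have h2 : ∀ b, volume.real (cube (child v b).1 (child v b).2) =
      volume.real (cube v.1 v.2) / 2 ^ n := fun b => by
    rw [volume_real_child v b]; field_simp
  simp only [h2, ← Finset.smul_sum] at h
  rw [card_children]
  have hv := (volume_real_cube_pos v.1 v.2).ne'
  have h3 := congrArg (fun z => (2 ^ n / volume.real (cube v.1 v.2)) • z) h
  simp only [smul_smul] at h3
  rw [div_mul_cancel₀ _ hv, div_mul_div_cancel₀ hv, div_self (by positivity), one_smul] at h3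
  exact h3.symm

theorem childMean_cubeMean {g : (Fin n → ℝ) → ℝ} (hg : ∀ v : CubeIndex n,
    IntegrableOn g (cube v.1 v.2)) : childMean child (cubeMean g) = cubeMean g := by
  funext v
  rw [childMean_apply, sum_cubeMean_child (hg v), smul_eq_mul, mul_div_cancel_left₀]
  simp

theorem norm_cubeMean_le (g : (Fin n → ℝ) → E) (v : CubeIndex n) :
    ‖cubeMean g v‖ ≤ cubeMean (fun x => ‖g x‖) v := by
  rw [cubeMean, cubeMean, setAverage_eq, setAverage_eq, norm_smul, smul_eq_mul, Real.norm_eq_abs,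
    abs_of_nonneg (inv_nonneg.2 (volume_real_cube_pos _ _).le)]
  gcongr
  exact norm_integral_le_integral_norm _

theorem cubeMean_sub_const [CompleteSpace E] {g : (Fin n → ℝ) → E} {v : CubeIndex n}
    (hg : IntegrableOn g (cube v.1 v.2)) (c : E) :
    cubeMean (fun x => g x - c) v = cubeMean g v - c := by
  have hv := (volume_real_cube_pos v.1 v.2).ne'
  rw [cubeMean, cubeMean, setAverage_eq, setAverage_eq,
    integral_sub hg (integrable_const c), smul_sub, setIntegral_const, inv_smul_smul₀ hv]

theorem cubeMean_nonneg {g : (Fin n → ℝ) → ℝ} (hg : 0 ≤ g) : 0 ≤ cubeMean g := fun v => by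
  rw [cubeMean, setAverage_eq]
  exact smul_nonneg (inv_nonneg.2 (volume_real_cube_pos _ _).le) (integral_nonneg hg)

theorem cubeMean_rpow_le {q : ℝ} (hq : 1 ≤ q) {g : (Fin n → ℝ) → ℝ} (hg : 0 ≤ g)
    {v : CubeIndex n} (h1 : IntegrableOn g (cube v.1 v.2))
    (h2 : IntegrableOn (fun x => g x ^ q) (cube v.1 v.2)) :
    cubeMean g v ^ q ≤ cubeMean (fun x => g x ^ q) v := by
  exact (convexOn_rpow hq).map_set_average_le
    (continuousOn_id.rpow_const fun x _ => Or.inr (by linarith)) isClosed_Ici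
    (volume_cube_ne_zero _ _) (volume_cube_ne_top _ _) (Eventually.of_forall hg) h1 h2

end Average

/-! ### The packing condition for dyadic `BMO` functions. -/

section BMO

variable {n : ℕ} {𝕜 : Type*} [RCLike 𝕜]

theorem isBounded_cube (j : ℤ) (m : Fin n → ℤ) : Bornology.IsBounded (cube j m) :=
  (Metric.isBounded_Icc (fun i => (m i : ℝ) / 2 ^ j) (fun i => ((m i : ℝ) + 1) / 2 ^ j)).subset
    fun _ hx => ⟨fun i => (hx i trivial).1, fun i => (hx i trivial).2.le⟩

theorem integrableOn_cube {E : Type*} [NormedAddCommGroup E] {a : (Fin n → ℝ) → E}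
    (ha : LocallyIntegrable a volume)
    (j : ℤ) (m : Fin n → ℤ) : IntegrableOn a (cube j m) :=
  (ha.integrableOn_isCompact (isBounded_cube j m).isCompact_closure).mono_set subset_closure

/-- The essential supremum controls every cube, since the sharp maximal function dominates the
oscillation on the whole cube, a set of positive measure. -/
theorem oscillation_le_bmoNorm (a : (Fin n → ℝ) → 𝕜) (j : ℤ) (m : Fin n → ℤ) :
    (volume (cube j m))⁻¹ * ∫⁻ y in cube j m, ‖a y - ⨍ z in cube j m, a z‖ₑ ≤ bmoNorm a := by
  have h : ∀ᵐ x, sharpMaximal a x ≤ bmoNorm a := ae_le_essSup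
  have h2 : ∃ x ∈ cube j m, sharpMaximal a x ≤ bmoNorm a := by
    by_contra! hc
    refine volume_cube_ne_zero j m (measure_mono_null (fun x hx => ?_) h)
    exact not_le.2 (hc x hx)
  obtain ⟨x, hx, hle⟩ := h2
  refine le_trans ?_ hle
  unfold sharpMaximal
  exact le_iSup₂_of_le j m (le_iSup_of_le (f := fun _ : x ∈ cube j m => (volume (cube j m))⁻¹ *
    ∫⁻ y in cube j m, ‖a y - ⨍ z in cube j m, a z‖ₑ) hx le_rfl)

theorem cubeMean_oscillation_le {a : (Fin n → ℝ) → 𝕜} (ha : MemBMO a) (v : CubeIndex n) :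
    cubeMean (fun x => ‖a x - cubeMean a v‖) v ≤ (bmoNorm a).toReal := by
  have h := oscillation_le_bmoNorm a v.1 v.2
  have h2 := ENNReal.toReal_mono ha.2.ne h
  refine le_of_eq_of_le ?_ h2
  have hint : IntegrableOn (fun x => a x - cubeMean a v) (cube v.1 v.2) :=
    (integrableOn_cube ha.1 _ _).sub (integrable_const _)
  rw [cubeMean, setAverage_eq, ENNReal.toReal_mul, ENNReal.toReal_inv, smul_eq_mul,
    integral_norm_eq_lintegral_enorm hint.aestronglyMeasurable]
  rfl

theorem norm_cubeMean_sub_le {a : (Fin n → ℝ) → 𝕜} (ha : LocallyIntegrable a volume)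
    (c : 𝕜) (v : CubeIndex n) :
    ‖cubeMean a v - c‖ ≤ cubeMean (fun x => ‖a x - c‖) v := by
  rw [← cubeMean_sub_const (integrableOn_cube ha _ _)]
  exact norm_cubeMean_le _ v

theorem potential_cubeMean_variance_le {a : (Fin n → ℝ) → 𝕜} (ha : MemBMO a) (d : ℕ)
    (v : CubeIndex n) :
    potential child d
      (fun v => (∑ b, ‖cubeMean a (child v b) - cubeMean a v‖ ^ 2) /
        Fintype.card (Fin n → Fin 2)) v ≤
      (8 + 4 * ((2 : ℝ) ^ n) ^ 2) * (bmoNorm a).toReal ^ 2 := by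
  rw [← card_children]
  exact potential_variance_le child (W := fun c => cubeMean fun x => ‖a x - c‖)
    (fun v => sum_cubeMean_child (integrableOn_cube ha.1 _ _))
    (fun c => childMean_cubeMean fun v =>
      ((integrableOn_cube ha.1 _ _).sub (integrable_const _)).norm)
    (norm_cubeMean_sub_le ha.1) (cubeMean_oscillation_le ha) d v

end BMO

/-! ### Haar coefficients and the paraproduct as a walk. -/

section Haar

variable {n : ℕ} {𝕜 : Type*} [RCLike 𝕜]

/-- The sign of the Haar function `h^ε_Q` on the children of `Q`. -/
def haarSign (ε : HaarIndex n) (b : Fin n → Fin 2) : ℝ :=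
  ∏ i, (-1 : ℝ) ^ ((ε.1 i).val * (b i : ℕ))

theorem abs_haarSign (ε : HaarIndex n) (b : Fin n → Fin 2) : |haarSign ε b| = 1 := by
  simp [haarSign, Finset.abs_prod]

theorem sum_haarSign (ε : HaarIndex n) : ∑ b, haarSign ε b = 0 := by
  have h := Finset.prod_univ_sum (fun _ : Fin n => (Finset.univ : Finset (Fin 2)))
    (fun i c => (-1 : ℝ) ^ ((ε.1 i).val * (c : ℕ)))
  rw [Fintype.piFinset_univ] at h
  unfold haarSign
  rw [← h]
  obtain ⟨i, hi⟩ := Function.ne_iff.1 ε.2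
  refine Finset.prod_eq_zero (Finset.mem_univ i) ?_
  have h1 : (ε.1 i).val = 1 := by
    have h2 := ZMod.val_lt (ε.1 i)
    have h3 : (ε.1 i).val ≠ 0 := fun h0 => hi ((ZMod.val_eq_zero _).1 h0)
    omega
  simp [h1, Fin.sum_univ_two]

theorem haarProfile_eq_zero (e : ZMod 2) {t : ℝ} (ht : ¬(0 ≤ t ∧ t < 1)) :
    haarProfile e t = 0 := by
  rw [haarProfile, Set.indicator_of_notMem, Set.indicator_of_notMem]
  · simp
  · rintro ⟨h1, h2⟩; exact ht ⟨by linarith, by linarith⟩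
  · rintro ⟨h1, h2⟩; exact ht ⟨by linarith, by linarith⟩

theorem haarProfile_eq_pow (e : ZMod 2) {t : ℝ} (c : Fin 2) (h1 : (c : ℕ) ≤ 2 * t)
    (h2 : 2 * t < (c : ℕ) + 1) : haarProfile e t = (-1) ^ (e.val * (c : ℕ)) := by
  fin_cases c
  · norm_num at h1 h2
    rw [haarProfile, Set.indicator_of_mem (show 2 * t ∈ Set.Ico (0 : ℝ) 1 from ⟨by linarith, h2⟩),
      Set.indicator_of_notMem (fun h => by linarith [h.1])]
    simp
  · norm_num at h1 h2
    rw [haarProfile, Set.indicator_of_notMem (fun h => by linarith [h.2]),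
      Set.indicator_of_mem (show 2 * t ∈ Set.Ico (1 : ℝ) 2 from ⟨h1, by linarith⟩)]
    simp

theorem haar_eq_zero (ε : HaarIndex n) {j : ℤ} {m : Fin n → ℤ} {x : Fin n → ℝ}
    (hx : x ∉ cube j m) : haar ε j m x = 0 := by
  rw [mem_cube_iff] at hx
  obtain ⟨i, hi⟩ := Function.ne_iff.1 hx
  rw [haar, haarMother, Finset.prod_eq_zero (Finset.mem_univ i), mul_zero]
  refine haarProfile_eq_zero _ fun h => hi ?_
  rw [location, Int.floor_eq_iff]
  exact ⟨by linarith, by linarith⟩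

theorem haar_eq_haarSign (ε : HaarIndex n) (v : CubeIndex n) (b : Fin n → Fin 2) {x : Fin n → ℝ}
    (hx : x ∈ cube (child v b).1 (child v b).2) :
    haar ε v.1 v.2 x = (2 : ℝ) ^ ((v.1 : ℝ) * (n : ℝ) / 2) * haarSign ε b := by
  rw [haar, haarMother, haarSign]
  congr 1
  refine Finset.prod_congr rfl fun i _ => ?_
  rw [mem_cube_iff] at hx
  have h := congrFun hx i
  rw [location, Int.floor_eq_iff] at h
  simp only [child] at h
  rw [zpow_add_one₀ two_ne_zero] at h
  push_cast at h
  exact haarProfile_eq_pow _ _ (by linarith) (by linarith)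

/-- The normalized Haar coefficient `|Q|^{-1/2} ⟨a, h^ε_Q⟩`. -/
def haarCoeff (a : (Fin n → ℝ) → 𝕜) (ε : HaarIndex n) (v : CubeIndex n) : 𝕜 :=
  ((2 : ℝ) ^ n)⁻¹ • ∑ b, haarSign ε b • cubeMean a (child v b)

theorem pairing_haar {a : (Fin n → ℝ) → 𝕜} (ha : LocallyIntegrable a volume) (ε : HaarIndex n)
    (v : CubeIndex n) :
    pairing a (haar ε v.1 v.2) = ((2 : ℝ) ^ ((v.1 : ℝ) * (n : ℝ) / 2) *
      volume.real (cube v.1 v.2)) • haarCoeff a ε v := by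
  set κ : ℝ := (2 : ℝ) ^ ((v.1 : ℝ) * (n : ℝ) / 2) with hκ
  have h0 : pairing a (haar ε v.1 v.2) = ∫ x in cube v.1 v.2, haar ε v.1 v.2 x • a x := by
    rw [pairing, setIntegral_eq_integral_of_forall_compl_eq_zero]
    intro x hx
    rw [haar_eq_zero ε hx, zero_smul]
  have hon : ∀ b, Set.EqOn (fun x => haar ε v.1 v.2 x • a x) (fun x => (κ * haarSign ε b) • a x)
      (cube (child v b).1 (child v b).2) := fun b x hx => by
    simp only [haar_eq_haarSign ε v b hx, hκ]
  have hint : IntegrableOn (fun x => haar ε v.1 v.2 x • a x) (cube v.1 v.2) := by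
    rw [cube_eq_iUnion_child, integrableOn_finite_iUnion]
    intro b
    rw [integrableOn_congr_fun (hon b) (measurableSet_cube _ _)]
    exact (integrableOn_cube ha _ _).smul (κ * haarSign ε b)
  rw [h0, integral_cube_eq_sum hint]
  rw [haarCoeff, Finset.smul_sum, Finset.smul_sum]
  refine Finset.sum_congr rfl fun b _ => ?_
  rw [setIntegral_congr_fun (measurableSet_cube _ _) (hon b), integral_smul, ← smul_cubeMean,
    smul_smul, smul_smul, smul_smul]
  congr 1
  rw [volume_real_child v b]
  field_simp

/-- The signs sum to zero, so the mean over the parent may be subtracted; Cauchy–Schwarz does the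
rest. -/
theorem norm_haarCoeff_sq_le (a : (Fin n → ℝ) → 𝕜) (ε : HaarIndex n) (v : CubeIndex n) :
    ‖haarCoeff a ε v‖ ^ 2 ≤ (∑ b, ‖cubeMean a (child v b) - cubeMean a v‖ ^ 2) /
        Fintype.card (Fin n → Fin 2) := by
  have h1 : haarCoeff a ε v =
      ((2 : ℝ) ^ n)⁻¹ • ∑ b, haarSign ε b • (cubeMean a (child v b) - cubeMean a v) := by
    simp only [haarCoeff, smul_sub, Finset.sum_sub_distrib, ← Finset.sum_smul, sum_haarSign,
      zero_smul, sub_zero]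
  have h2 : ‖∑ b, haarSign ε b • (cubeMean a (child v b) - cubeMean a v)‖ ≤
      ∑ b, ‖cubeMean a (child v b) - cubeMean a v‖ := by
    refine (norm_sum_le _ _).trans (le_of_eq ?_)
    simp only [norm_smul, Real.norm_eq_abs, abs_haarSign, one_mul]
  have h3 := sq_sum_le_card_mul_sum_sq (s := Finset.univ)
    (f := fun b => ‖cubeMean a (child v b) - cubeMean a v‖)
  rw [Finset.card_univ, card_children] at h3
  rw [h1, norm_smul, mul_pow, card_children, norm_inv, norm_pow, Real.norm_ofNat]
  have h4 := (pow_le_pow_left₀ (norm_nonneg _) h2 2).trans h3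
  have hN : (0 : ℝ) < 2 ^ n := by positivity
  rw [inv_pow, inv_mul_eq_div, div_le_div_iff₀ (by positivity) hN]
  nlinarith

theorem pairing_indicator (f : (Fin n → ℝ) → 𝕜) (v : CubeIndex n) :
    pairing f ((cube v.1 v.2).indicator fun _ => (1 : ℝ)) =
      volume.real (cube v.1 v.2) • cubeMean f v := by
  rw [smul_cubeMean, ← integral_indicator (measurableSet_cube _ _), pairing]
  congr 1
  funext x
  by_cases hx : x ∈ cube v.1 v.2 <;> simp [hx]

/-- The generation-`j` function that takes the value `± D Q` on the children of the cubes `Q`, with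
the signs of the Haar functions. -/
def haarStep (D : CubeIndex n → 𝕜) (ε : HaarIndex n) (j : ℤ) (x : Fin n → ℝ) : 𝕜 :=
  haarSign ε (digit j x) • D (j, location j x)

theorem haarStep_of_mem (D : CubeIndex n → 𝕜) (ε : HaarIndex n) {v : CubeIndex n}
    {b : Fin n → Fin 2} {x : Fin n → ℝ} (hx : x ∈ cube (child v b).1 (child v b).2) :
    haarStep D ε v.1 x = haarSign ε b • D v := by
  obtain ⟨h1, h2⟩ := digit_eq_of_mem hx
  rw [haarStep, h1, h2]

theorem norm_haarStep (D : CubeIndex n → 𝕜) (ε : HaarIndex n) (j : ℤ) (x : Fin n → ℝ) :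
    ‖haarStep D ε j x‖ = ‖D (j, location j x)‖ := by
  rw [haarStep, norm_smul, Real.norm_eq_abs, abs_haarSign, one_mul]

theorem paraproductLevel_eq_haarStep {a : (Fin n → ℝ) → 𝕜} (ha : LocallyIntegrable a volume)
    (f : (Fin n → ℝ) → 𝕜) (ε : HaarIndex n) (j : ℤ) :
    paraproductLevel a f ε j = haarStep (fun v => cubeMean f v * haarCoeff a ε v) ε j := by
  funext x
  rw [paraproductLevel, tsum_eq_single (location j x)]
  · set v : CubeIndex n := (j, location j x) with hv
    have hx : x ∈ cube (child v (digit j x)).1 (child v (digit j x)).2 :=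
      mem_cube_iff.2 (location_succ j x)
    have h1 := pairing_indicator f v
    have h2 := pairing_haar ha ε v
    have h3 := haar_eq_haarSign ε v _ hx
    simp only [hv] at h1 h2 h3
    rw [h1, h2, h3, haarStep, smul_mul_smul_comm, smul_smul]
    congr 1
    have hV := (volume_real_cube_pos j (location j x)).ne'
    -- The two `L²` normalizations of the Haar functions multiply to `|Q|⁻¹`.
    have h4 : (2 : ℝ) ^ ((j : ℝ) * n / 2) * (2 : ℝ) ^ ((j : ℝ) * n / 2) *
        volume.real (cube j (location j x)) = 1 := by
      rw [volume_real_cube, ← Real.rpow_add two_pos, add_halves, Real.rpow_mul two_pos.le,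
        Real.rpow_intCast, Real.rpow_natCast, ← mul_pow, mul_inv_cancel₀ (by positivity), one_pow]
    field_simp
    linear_combination haarSign ε (digit j x) * h4
  · intro m hm
    rw [haar_eq_zero ε (fun hx => hm (mem_cube_iff.1 hx).symm), zero_div, zero_smul]

/-- The bridge from integrals to trees. The coarsest generation is constant on each child and is
absorbed into the starting point `z`, which is why `z` is arbitrary. -/
theorem lintegral_haarStep_sum (D : CubeIndex n → 𝕜) (ε : HaarIndex n) {q : ℝ} (hq : 0 ≤ q)
    (d : ℕ) (v : CubeIndex n) (z : 𝕜) :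
    ∫⁻ x in cube v.1 v.2, ‖z + ∑ k ∈ Finset.range d, haarStep D ε (v.1 + k) x‖ₑ ^ q =
      ENNReal.ofReal (volume.real (cube v.1 v.2) *
        (childMean (walkTree child (haarSign ε) D) ^ d) (fun w => ‖w.2‖ ^ q) (v, z)) := by
  induction d generalizing v z with
  | zero =>
    simp only [Finset.range_zero, Finset.sum_empty, add_zero, lintegral_const, pow_zero,
      Module.End.one_apply, Measure.restrict_apply_univ]
    rw [mul_comm, ENNReal.ofReal_mul (volume_real_cube_pos _ _).le, ofReal_measureReal (volume_cube_ne_top _ _),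
      ← ENNReal.ofReal_rpow_of_nonneg (norm_nonneg _) hq, ofReal_norm, mul_comm]
  | succ d ih =>
    rw [lintegral_cube_eq_sum, childMean_pow_succ_apply]
    have h : ∀ b, ∫⁻ x in cube (child v b).1 (child v b).2,
        ‖z + ∑ k ∈ Finset.range (d + 1), haarStep D ε (v.1 + k) x‖ₑ ^ q =
        ENNReal.ofReal (volume.real (cube (child v b).1 (child v b).2) *
        (childMean (walkTree child (haarSign ε) D) ^ d) (fun w => ‖w.2‖ ^ q)
          (walkTree child (haarSign ε) D (v, z) b)) := by
      intro b
      rw [walkTree, ← ih]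
      refine setLIntegral_congr_fun (measurableSet_cube _ _) fun x hx => ?_
      simp only
      rw [Finset.sum_range_succ', Nat.cast_zero, add_zero, haarStep_of_mem D ε hx,
        add_comm (∑ k ∈ _, _), ← add_assoc]
      simp only [child, Nat.cast_add, Nat.cast_one, add_assoc, add_comm (1 : ℤ)]
    simp only [h]
    rw [← ENNReal.ofReal_sum_of_nonneg]
    · congr 1
      rw [card_children, Finset.sum_div, Finset.mul_sum]
      refine Finset.sum_congr rfl fun b _ => ?_
      rw [volume_real_child v b]
      field_simp
    · intro b _
      exact mul_nonneg (volume_real_cube_pos _ _).le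
        (childMean_pow_nonneg _ (fun w => by positivity) d _)

end Haar

/-! ### Discarding the first generations. -/

section Truncation

variable {σ ι : Type*} [Fintype ι]

theorem childMean_pow_ite (ch : σ → ι → σ) {lev : σ → ℤ} (hlev : ∀ v b, lev (ch v b) = lev v + 1)
    (M : ℤ) (G : σ → ℝ) (k : ℕ) (v : σ) :
    (childMean ch ^ k) (fun w => if M ≤ lev w then G w else 0) v =
      if M ≤ lev v + k then (childMean ch ^ k) G v else 0 := by
  induction k generalizing v with
  | zero => simp
  | succ k ih =>
    simp only [childMean_pow_succ_apply, ih, hlev]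
    push_cast
    simp only [add_assoc, add_comm (1 : ℤ)]
    split_ifs <;> simp

/-- Lets a tail of the paraproduct be treated as a full walk whose first `e` steps vanish, at the
cost of an increment of the Carleson sum. -/
theorem potential_ite (ch : σ → ι → σ) {lev : σ → ℤ} (hlev : ∀ v b, lev (ch v b) = lev v + 1)
    (G : σ → ℝ) {e d : ℕ} (hed : e ≤ d) (v : σ) :
    potential ch d (fun w => if lev v + e ≤ lev w then G w else 0) v =
      potential ch d G v - potential ch e G v := by
  simp only [potential_apply, childMean_pow_ite ch hlev]
  rw [← Finset.sum_range_add_sum_Ico _ hed, ← Finset.sum_range_add_sum_Ico _ hed,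
    add_sub_cancel_left]
  have h1 : ∀ k ∈ Finset.range e, (if lev v + (e : ℤ) ≤ lev v + (k : ℤ) then
      (childMean ch ^ k) G v else 0) = 0 := fun k hk => by
    rw [Finset.mem_range] at hk
    rw [if_neg (by omega)]
  rw [Finset.sum_eq_zero h1, zero_add]
  refine Finset.sum_congr rfl fun k hk => ?_
  rw [Finset.mem_Ico] at hk
  rw [if_pos (by omega)]

end Truncation

/-! ### Moment bounds for tails of the normalized paraproduct. -/

section Estimate

variable {n : ℕ} {𝕜 : Type*} [RCLike 𝕜]

/-- The Haar coefficient of `a` divided by the `BMO` norm of `a`. -/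
def unitCoeff (a : (Fin n → ℝ) → 𝕜) (ε : HaarIndex n) (v : CubeIndex n) : 𝕜 :=
  (bmoNorm a).toReal⁻¹ • haarCoeff a ε v

theorem potential_haarCoeff_le {a : (Fin n → ℝ) → 𝕜} (ha : MemBMO a) (ε : HaarIndex n) (d : ℕ)
    (v : CubeIndex n) :
    potential child d (fun v => ‖haarCoeff a ε v‖ ^ 2) v ≤
      (8 + 4 * ((2 : ℝ) ^ n) ^ 2) * (bmoNorm a).toReal ^ 2 :=
  (potential_mono child d (fun v => norm_haarCoeff_sq_le a ε v) v).trans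
    (potential_cubeMean_variance_le ha d v)

theorem norm_haarCoeff_le {a : (Fin n → ℝ) → 𝕜} (ha : MemBMO a) (ε : HaarIndex n)
    (v : CubeIndex n) :
    ‖haarCoeff a ε v‖ ≤ √(8 + 4 * ((2 : ℝ) ^ n) ^ 2) * (bmoNorm a).toReal := by
  have h := potential_haarCoeff_le ha ε 1 v
  simp only [potential_succ, potential_zero, map_zero, add_zero] at h
  rw [← Real.sqrt_sq (ENNReal.toReal_nonneg (a := bmoNorm a)), ← Real.sqrt_mul (by positivity)]
  exact Real.le_sqrt_of_sq_le h

/-- If the `BMO` norm is zero, all Haar coefficients vanish, so the convention `0⁻¹ = 0` loses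
nothing. -/
theorem smul_unitCoeff {a : (Fin n → ℝ) → 𝕜} (ha : MemBMO a) (ε : HaarIndex n)
    (v : CubeIndex n) : (bmoNorm a).toReal • unitCoeff a ε v = haarCoeff a ε v := by
  rw [unitCoeff]
  rcases eq_or_ne (bmoNorm a).toReal 0 with h | h
  · have := norm_haarCoeff_le ha ε v
    rw [h, mul_zero, norm_le_zero_iff] at this
    rw [this, smul_zero, smul_zero]
  · rw [smul_inv_smul₀ h]

theorem potential_unitCoeff_le {a : (Fin n → ℝ) → 𝕜} (ha : MemBMO a) (ε : HaarIndex n) (d : ℕ)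
    (v : CubeIndex n) :
    potential child d (fun v => ‖unitCoeff a ε v‖ ^ 2) v ≤ 8 + 4 * ((2 : ℝ) ^ n) ^ 2 := by
  set B := (bmoNorm a).toReal with hB
  have h := potential_haarCoeff_le ha ε d v
  have e : (fun v => ‖unitCoeff a ε v‖ ^ 2) = (B⁻¹ ^ 2) • fun v => ‖haarCoeff a ε v‖ ^ 2 := by
    funext v
    rw [unitCoeff, norm_smul, mul_pow, Pi.smul_apply, smul_eq_mul, Real.norm_eq_abs, sq_abs]
  have e2 : potential child d (fun v => ‖unitCoeff a ε v‖ ^ 2) v =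
      B⁻¹ ^ 2 * potential child d (fun v => ‖haarCoeff a ε v‖ ^ 2) v := by
    rw [e]
    simp only [potential_apply, map_smul, Pi.smul_apply, smul_eq_mul, Finset.mul_sum]
  rw [e2]
  refine (mul_le_mul_of_nonneg_left h (by positivity)).trans ?_
  rw [mul_left_comm, ← mul_pow]
  have : (B⁻¹ * B) ^ 2 ≤ 1 := pow_le_one₀ (by positivity) inv_mul_le_one
  exact mul_le_of_le_one_right (by positivity) this

variable (q : ℝ) (a f : (Fin n → ℝ) → 𝕜) (ε : HaarIndex n)

/-- The generation-`j` paraproduct of `a` and `f`, divided by the `BMO` norm of `a`. -/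
def unitStep (j : ℤ) : (Fin n → ℝ) → 𝕜 := haarStep (fun v => cubeMean f v * unitCoeff a ε v) ε j

/-- The tree of dyadic cubes that remember the running maximum of the mean values of `‖f‖`. -/
abbrev cubeMaxTree (f : (Fin n → ℝ) → 𝕜) : CubeIndex n × ℝ → (Fin n → Fin 2) → CubeIndex n × ℝ :=
  maxTree child (cubeMean fun x => ‖f x‖)

/-- The running maximum of the mean values of `‖f‖`. -/
abbrev cubeMax (f : (Fin n → ℝ) → 𝕜) : CubeIndex n × ℝ → ℝ := runMax (cubeMean fun x => ‖f x‖)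

/-- The Carleson sum `|R|⁻¹ ∑ |Q| |β_Q|² F_Q ^ q` over the first `d` generations of cubes `Q ⊆ R`,
with the normalized Haar coefficients `β_Q` of `a` and the maxima `F_Q` of the means of `‖f‖`. -/
def carlesonSum (d : ℕ) (v : CubeIndex n) : ℝ :=
  potential (cubeMaxTree f) d (fun w => ‖unitCoeff a ε w.1‖ ^ 2 * cubeMax f w ^ q) (v, 0)

variable {q a f}

theorem cubeMean_norm_nonneg (f : (Fin n → ℝ) → 𝕜) : 0 ≤ cubeMean fun x => ‖f x‖ :=
  cubeMean_nonneg fun _ => norm_nonneg _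

theorem cubeMax_nonneg (f : (Fin n → ℝ) → 𝕜) : 0 ≤ cubeMax f := fun w =>
  (cubeMean_norm_nonneg f w.1).trans (le_runMax _ w)

theorem carlesonSum_mono (v : CubeIndex n) : Monotone fun d => carlesonSum q a f ε d v := by
  refine monotone_nat_of_le_succ fun d => ?_
  simp only [carlesonSum, potential_apply]
  rw [Finset.sum_range_succ, le_add_iff_nonneg_right]
  exact childMean_pow_nonneg _
    (fun w => mul_nonneg (sq_nonneg _) (Real.rpow_nonneg (cubeMax_nonneg f w) _)) d _

/-- Doob's inequality for the means of `‖f‖`, then Jensen on the cubes of generation `d`; the bound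
does not depend on `d`. -/
theorem exists_cubeMax_moment_le (hq : 1 < q) :
    ∃ C : ℝ, 0 < C ∧ ∀ {n : ℕ} {𝕜 : Type*} [RCLike 𝕜] (f : (Fin n → ℝ) → 𝕜),
      (∀ v : CubeIndex n, IntegrableOn f (cube v.1 v.2)) →
      (∀ v : CubeIndex n, IntegrableOn (fun x => ‖f x‖ ^ q) (cube v.1 v.2)) → ∀ d v,
      (childMean (cubeMaxTree f) ^ d) (fun w => cubeMax f w ^ q) (v, 0) ≤
        C * cubeMean (fun x => ‖f x‖ ^ q) v := by
  obtain ⟨C, hC, h⟩ := exists_doob hq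
  refine ⟨C, hC, fun {n 𝕜} _ f h1 h2 d v => ?_⟩
  refine (h child _ (cubeMean_norm_nonneg f)
    (childMean_cubeMean fun v => (h1 v).norm).ge d v).trans ?_
  gcongr
  have h3 : ∀ d : ℕ, (childMean child ^ d) (cubeMean fun x => ‖f x‖ ^ q) =
      cubeMean fun x => ‖f x‖ ^ q := by
    intro d
    induction d with
    | zero => simp
    | succ d ih => rw [pow_succ', Module.End.mul_apply, ih, childMean_cubeMean h2]
  conv_rhs => rw [← h3 d]
  exact childMean_pow_mono child
    (fun v => cubeMean_rpow_le hq.le (fun x => norm_nonneg _) (h1 v).norm (h2 v)) d v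

theorem carlesonSum_le (hq : 0 ≤ q) (ha : MemBMO a) (d : ℕ) (v : CubeIndex n) :
    carlesonSum q a f ε d v ≤ (8 + 4 * ((2 : ℝ) ^ n) ^ 2) *
      (childMean (cubeMaxTree f) ^ d) (fun w => cubeMax f w ^ q) (v, 0) := by
  refine potential_mul_le' (cubeMaxTree f) (w := fun w => ‖unitCoeff a ε w.1‖ ^ 2)
    (fun d w => ?_) (fun w b => ?_) (fun w => Real.rpow_nonneg (cubeMax_nonneg f w) _) d (v, 0)
  · rw [potential_comp (π := Prod.fst) (ch' := child) (fun _ _ => rfl)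
      (fun v => ‖unitCoeff a ε v‖ ^ 2)]
    exact potential_unitCoeff_le ha ε d w.1
  · exact Real.rpow_le_rpow (cubeMax_nonneg f w) (runMax_le_runMax child _ w b) hq

/-- One estimate for two uses: `e = 0` and `η = 1` give boundedness, small `η` and large `e` give
the Cauchy property. -/
theorem exists_walk_tail_le (hq : 1 < q) (n : ℕ) {η : ℝ} (hη : 0 < η) :
    ∃ C : ℝ, 0 < C ∧ ∀ {𝕜 : Type*} [RCLike 𝕜] (a f : (Fin n → ℝ) → 𝕜) (ε : HaarIndex n),
      MemBMO a → ∀ {e d : ℕ}, e ≤ d → ∀ v : CubeIndex n,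
      ∫⁻ x in cube v.1 v.2, ‖∑ k ∈ Finset.Ico e d, unitStep a f ε (v.1 + k) x‖ₑ ^ q ≤
        ENNReal.ofReal (volume.real (cube v.1 v.2) *
          (η * (childMean (cubeMaxTree f) ^ d) (fun w => cubeMax f w ^ q) (v, 0) +
            C * (carlesonSum q a f ε d v - carlesonSum q a f ε e v))) := by
  obtain ⟨C, hC, h⟩ := exists_walk_moment_le hq (K := 8 + 4 * ((2 : ℝ) ^ n) ^ 2) (by positivity) hη
  refine ⟨C, hC, fun {𝕜} _ a f ε ha e d hed v => ?_⟩
  set D : CubeIndex n → 𝕜 := fun w =>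
    if v.1 + e ≤ w.1 then cubeMean f w * unitCoeff a ε w else 0 with hD
  have hstep : ∀ x, ∑ k ∈ Finset.Ico e d, unitStep a f ε (v.1 + k) x =
      0 + ∑ k ∈ Finset.range d, haarStep D ε (v.1 + k) x := by
    intro x
    rw [zero_add, ← Finset.sum_range_add_sum_Ico _ hed]
    rw [Finset.sum_eq_zero (s := Finset.range e), zero_add]
    · refine Finset.sum_congr rfl fun k hk => ?_
      rw [Finset.mem_Ico] at hk
      simp only [unitStep, haarStep, hD]
      rw [if_pos (by omega)]
    · intro k hk
      rw [Finset.mem_range] at hk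
      simp only [haarStep, hD]
      rw [if_neg (by omega), smul_zero]
  simp only [hstep]
  rw [lintegral_haarStep_sum D ε (by linarith) d v 0]
  refine ENNReal.ofReal_le_ofReal (mul_le_mul_of_nonneg_left ?_ (volume_real_cube_pos _ _).le)
  set s := haarSign ε with hs
  set α : CubeIndex n × ℝ → ℝ := fun w => if v.1 + e ≤ w.1.1 then ‖unitCoeff a ε w.1‖ else 0 with hα
  have hα0 : 0 ≤ α := fun w => by
    simp only [hα, Pi.zero_apply]; split_ifs <;> positivity
  have key := h (cubeMaxTree f) s (fun w => D w.1) α (cubeMax f) (sum_haarSign ε)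
    (fun b => (abs_haarSign ε b).le) hα0 (cubeMax_nonneg f)
    (runMax_le_runMax child _) (fun w => ?_) (fun d w => ?_) d (v, 0)
  -- The moment bound lives on nodes that also remember the running maximum; the walk itself ignores
  -- this memory.
  · have e1 : (childMean (walkTree (cubeMaxTree f) s fun w => D w.1) ^ d)
        (fun w => ‖w.2‖ ^ q) ((v, 0), 0) =
        (childMean (walkTree child s D) ^ d) (fun w => ‖w.2‖ ^ q) (v, 0) :=
      childMean_pow_comp (ch := walkTree (cubeMaxTree f) s fun w => D w.1)
        (ch' := walkTree child s D) (π := fun w => (w.1.1, w.2)) (fun _ _ => rfl)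
        (fun w => ‖w.2‖ ^ q) d ((v, 0), 0)
    have e2 : (fun w => α w ^ 2 * cubeMax f w ^ q) = fun w : CubeIndex n × ℝ =>
        if v.1 + e ≤ w.1.1 then ‖unitCoeff a ε w.1‖ ^ 2 * cubeMax f w ^ q else 0 := by
      funext w
      simp only [hα]; split_ifs <;> simp
    have e3 := potential_ite (cubeMaxTree f) (lev := fun w => w.1.1) (fun _ _ => rfl)
      (fun w => ‖unitCoeff a ε w.1‖ ^ 2 * cubeMax f w ^ q) hed (v, 0)
    rw [e1, e2] at key
    rw [carlesonSum, carlesonSum, ← e3]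
    exact key
  · simp only [hD, hα]
    split_ifs
    · rw [norm_mul, mul_comm]
      gcongr
      exact (norm_cubeMean_le f w.1).trans (le_runMax _ w)
    · simp
  · refine le_trans (potential_mono _ d (w' := fun w => ‖unitCoeff a ε w.1‖ ^ 2) (fun w => ?_) w) ?_
    · simp only [hα]; split_ifs
      · exact le_rfl
      · simp
    · rw [potential_comp (π := Prod.fst) (ch' := child) (fun _ _ => rfl)
        (fun v => ‖unitCoeff a ε v‖ ^ 2)]
      exact potential_unitCoeff_le ha ε d w.1

end Estimate

/-! ### Splitting two-sided sums, and completeness of `L^p`. -/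

section Auxiliary

theorem sum_Ico_int_eq {M : Type*} [AddCommMonoid M] (u : ℤ → M) (j : ℤ) (d e : ℕ) :
    ∑ i ∈ Finset.Ico (j - d) (j + e), u i =
      ∑ k ∈ Finset.range d, u (j - (k + 1)) + ∑ k ∈ Finset.range e, u (j + k) := by
  induction d with
  | zero =>
    simp only [Nat.cast_zero, sub_zero, Finset.range_zero, Finset.sum_empty, zero_add]
    induction e with
    | zero => simp
    | succ e ih =>
      have h : Finset.Ico j (j + (e + 1 : ℕ)) = insert (j + (e : ℤ)) (Finset.Ico j (j + e)) := by
        ext i; simp only [Finset.mem_Ico, Finset.mem_insert]; omega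
      rw [h, Finset.sum_insert (by simp), ih, Finset.sum_range_succ, add_comm]
  | succ d ih =>
    have h : Finset.Ico (j - (d + 1 : ℕ)) (j + e) =
        insert (j - ((d : ℤ) + 1)) (Finset.Ico (j - d) (j + e)) := by
      ext i; simp only [Finset.mem_Ico, Finset.mem_insert]; omega
    rw [h, Finset.sum_insert (by rw [Finset.mem_Ico]; omega), ih, Finset.sum_range_succ, ← add_assoc,
      add_comm (u _)]

theorem exists_tendsto_eLpNorm_of_cauchy {α E : Type*} [MeasurableSpace α] {μ : Measure α}
    [NormedAddCommGroup E] [CompleteSpace E] {p : ℝ≥0∞} (hp : 1 ≤ p) {s : ℕ → α → E}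
    (hs : ∀ k, MemLp (s k) p μ)
    (hc : ∀ δ : ℝ≥0∞, 0 < δ → ∃ N, ∀ k ≥ N, eLpNorm (s k - s N) p μ < δ) :
    ∃ g, MemLp g p μ ∧ Tendsto (fun k => eLpNorm (s k - g) p μ) atTop (𝓝 0) := by
  have : Fact (1 ≤ p) := ⟨hp⟩
  have h : CauchySeq fun k => (hs k).toLp (s k) := by
    rw [EMetric.cauchySeq_iff']
    intro δ hδ
    obtain ⟨N, hN⟩ := hc δ hδ
    exact ⟨N, fun k hk => by rw [Lp.edist_toLp_toLp]; exact hN k hk⟩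
  obtain ⟨g, hg⟩ := cauchySeq_tendsto_of_complete h
  refine ⟨g, Lp.memLp g, ?_⟩
  rw [← Lp.tendsto_Lp_iff_tendsto_eLpNorm'' s hs g (Lp.memLp g), Lp.toLp_coeFn]
  exact hg

end Auxiliary

/-! ### The `L^q` bound and convergence inside one cube. -/

section Local

variable {n : ℕ} {𝕜 : Type*} [RCLike 𝕜] {p q : ℝ}

theorem morreyNorm_eq (hq : 0 < q) (f : (Fin n → ℝ) → 𝕜) :
    morreyNorm p q f = ⨆ (j : ℤ) (m : Fin n → ℤ), volume (cube j m) ^ (1 / p - 1 / q) *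
      eLpNorm f (ENNReal.ofReal q) (volume.restrict (cube j m)) := by
  simp only [eLpNorm_eq_lintegral_rpow_enorm_toReal (ENNReal.ofReal_pos.2 hq).ne'
    ENNReal.ofReal_ne_top, ENNReal.toReal_ofReal hq.le]
  rfl

theorem le_morreyNorm (hq : 0 < q) (f : (Fin n → ℝ) → 𝕜) (v : CubeIndex n) :
    volume (cube v.1 v.2) ^ (1 / p - 1 / q) *
      eLpNorm f (ENNReal.ofReal q) (volume.restrict (cube v.1 v.2)) ≤ morreyNorm p q f := by
  rw [morreyNorm_eq hq]
  exact le_iSup₂_of_le v.1 v.2 le_rfl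

theorem morreyNorm_const_smul (hq : 0 < q) (c : ℝ) (f : (Fin n → ℝ) → 𝕜) :
    morreyNorm p q (c • f) ≤ ‖c‖ₑ * morreyNorm p q f := by
  rw [morreyNorm_eq hq]
  refine iSup₂_le fun j m => ?_
  rw [eLpNorm_const_smul, mul_left_comm]
  gcongr
  exact le_morreyNorm hq f (j, m)

theorem MemMorrey.memLp (hq : 0 < q) {f : (Fin n → ℝ) → 𝕜} (hf : MemMorrey p q f)
    (v : CubeIndex n) : MemLp f (ENNReal.ofReal q) (volume.restrict (cube v.1 v.2)) := by
  refine ⟨hf.1.restrict, ?_⟩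
  have h := (le_morreyNorm (p := p) hq f v).trans_lt hf.2
  refine ENNReal.lt_top_of_mul_ne_top_right h.ne ?_
  exact (ENNReal.rpow_pos (pos_iff_ne_zero.2 (volume_cube_ne_zero _ _))
    (volume_cube_ne_top _ _)).ne'

theorem measurable_location (j : ℤ) : Measurable (location (n := n) j) :=
  measurable_pi_lambda _ fun i => Int.measurable_floor.comp ((measurable_pi_apply i).const_mul _)

theorem stronglyMeasurable_haarStep (D : CubeIndex n → 𝕜) (ε : HaarIndex n) (j : ℤ) :
    StronglyMeasurable (haarStep D ε j) := by
  have h := (StronglyMeasurable.of_discrete (f := fun l : (Fin n → ℤ) × (Fin n → ℤ) =>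
    haarSign ε (fun i => if l.2 i = 2 * l.1 i then 0 else 1) • D (j, l.1))).comp_measurable
    ((measurable_location j).prodMk (measurable_location (j + 1)))
  exact h

theorem stronglyMeasurable_unitStep (a f : (Fin n → ℝ) → 𝕜) (ε : HaarIndex n) (j : ℤ) :
    StronglyMeasurable (unitStep a f ε j) := stronglyMeasurable_haarStep _ _ _

theorem stronglyMeasurable_sum_unitStep (a f : (Fin n → ℝ) → 𝕜) (ε : HaarIndex n)
    {ι : Type*} (s : Finset ι) (l : ι → ℤ) :
    StronglyMeasurable fun x => ∑ k ∈ s, unitStep a f ε (l k) x :=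
  Finset.stronglyMeasurable_fun_sum s fun k _ => stronglyMeasurable_unitStep a f ε (l k)

theorem integrableOn_of_memLp (hq : 1 < q) {f : (Fin n → ℝ) → 𝕜}
    (hf : ∀ v : CubeIndex n, MemLp f (ENNReal.ofReal q) (volume.restrict (cube v.1 v.2)))
    (v : CubeIndex n) : IntegrableOn f (cube v.1 v.2) :=
  (hf v).integrable (by simpa using hq.le)

theorem integrableOn_rpow_of_memLp (hq : 1 < q) {f : (Fin n → ℝ) → 𝕜}
    (hf : ∀ v : CubeIndex n, MemLp f (ENNReal.ofReal q) (volume.restrict (cube v.1 v.2)))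
    (v : CubeIndex n) : IntegrableOn (fun x => ‖f x‖ ^ q) (cube v.1 v.2) := by
  have h := (hf v).integrable_norm_rpow (ENNReal.ofReal_pos.2 (by linarith)).ne'
    ENNReal.ofReal_ne_top
  rwa [ENNReal.toReal_ofReal (by linarith)] at h

theorem ofReal_volume_mul_cubeMean (hq : 1 < q) {f : (Fin n → ℝ) → 𝕜}
    (hf : ∀ v : CubeIndex n, MemLp f (ENNReal.ofReal q) (volume.restrict (cube v.1 v.2)))
    (v : CubeIndex n) :
    ENNReal.ofReal (volume.real (cube v.1 v.2) * cubeMean (fun x => ‖f x‖ ^ q) v) =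
      ∫⁻ x in cube v.1 v.2, ‖f x‖ₑ ^ q := by
  have hq0 : 0 ≤ q := by linarith
  rw [← smul_eq_mul, smul_cubeMean, ofReal_integral_eq_lintegral_ofReal
    (integrableOn_rpow_of_memLp hq hf v) (Eventually.of_forall fun x => by positivity)]
  refine lintegral_congr fun x => ?_
  rw [← ENNReal.ofReal_rpow_of_nonneg (norm_nonneg _) hq0, ofReal_norm]

theorem eLpNorm_ofReal_eq (hq : 0 < q) {α : Type*} [MeasurableSpace α] (μ : Measure α)
    (f : α → 𝕜) : eLpNorm f (ENNReal.ofReal q) μ = (∫⁻ x, ‖f x‖ₑ ^ q ∂μ) ^ (1 / q) := by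
  rw [eLpNorm_eq_lintegral_rpow_enorm_toReal (ENNReal.ofReal_pos.2 hq).ne'
    ENNReal.ofReal_ne_top, ENNReal.toReal_ofReal hq.le]

/-- The `L^q` bound for the dyadic paraproduct on a cube. -/
theorem exists_eLpNorm_sum_unitStep_le (hq : 1 < q) (n : ℕ) :
    ∃ C : ℝ≥0, ∀ {𝕜 : Type*} [RCLike 𝕜] (a f : (Fin n → ℝ) → 𝕜) (ε : HaarIndex n),
      MemBMO a →
      (∀ v : CubeIndex n, MemLp f (ENNReal.ofReal q) (volume.restrict (cube v.1 v.2))) →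
      ∀ (d : ℕ) (v : CubeIndex n),
      eLpNorm (fun x => ∑ k ∈ Finset.range d, unitStep a f ε (v.1 + k) x) (ENNReal.ofReal q)
        (volume.restrict (cube v.1 v.2)) ≤
      C * eLpNorm f (ENNReal.ofReal q) (volume.restrict (cube v.1 v.2)) := by
  obtain ⟨C₁, hC₁, h₁⟩ := exists_walk_tail_le hq n one_pos
  obtain ⟨C₂, hC₂, h₂⟩ := exists_cubeMax_moment_le hq
  set K : ℝ := 8 + 4 * ((2 : ℝ) ^ n) ^ 2 with hK
  have hK0 : 0 < K := by positivity
  set L : ℝ := (1 + C₁ * K) * C₂ with hL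
  have hL0 : 0 ≤ L := by positivity
  refine ⟨(ENNReal.ofReal L ^ (1 / q)).toNNReal, fun {𝕜} _ a f ε ha hf d v => ?_⟩
  have hq0 : 0 < q := by linarith
  rw [ENNReal.coe_toNNReal (ENNReal.rpow_ne_top_of_nonneg (by positivity) ENNReal.ofReal_ne_top),
    eLpNorm_ofReal_eq hq0, eLpNorm_ofReal_eq hq0, ← ENNReal.mul_rpow_of_nonneg _ _ (by positivity)]
  refine ENNReal.rpow_le_rpow ?_ (by positivity)
  have h := h₁ a f ε ha (Nat.zero_le d) v
  rw [Nat.Ico_zero_eq_range] at h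
  refine h.trans ?_
  rw [← ofReal_volume_mul_cubeMean hq hf v, ← ENNReal.ofReal_mul hL0, mul_left_comm]
  refine ENNReal.ofReal_le_ofReal (mul_le_mul_of_nonneg_left ?_ (volume_real_cube_pos _ _).le)
  have h3 := carlesonSum_le (q := q) (f := f) ε hq0.le ha d v
  have h4 := h₂ f (integrableOn_of_memLp hq hf) (integrableOn_rpow_of_memLp hq hf) d v
  have h0 : carlesonSum q a f ε 0 v = 0 := by simp [carlesonSum, potential_zero]
  rw [h0, sub_zero, one_mul]
  calc _ ≤ (childMean (cubeMaxTree f) ^ d) (fun w => cubeMax f w ^ q) (v, 0) +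
        C₁ * (K * (childMean (cubeMaxTree f) ^ d) (fun w => cubeMax f w ^ q) (v, 0)) := by gcongr
    _ = (1 + C₁ * K) * (childMean (cubeMaxTree f) ^ d) (fun w => cubeMax f w ^ q) (v, 0) := by ring
    _ ≤ (1 + C₁ * K) * (C₂ * cubeMean (fun x => ‖f x‖ ^ q) v) := by gcongr
    _ = _ := by ring

/-- The Carleson sums are increasing and bounded in `d`, so their increments become small, while the
moment of the maximum, which does not decay, carries the free factor `η`. -/
theorem cauchy_sum_unitStep (hq : 1 < q) {a f : (Fin n → ℝ) → 𝕜} (ε : HaarIndex n)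
    (ha : MemBMO a)
    (hf : ∀ v : CubeIndex n, MemLp f (ENNReal.ofReal q) (volume.restrict (cube v.1 v.2)))
    (v : CubeIndex n) {δ : ℝ≥0∞} (hδ : 0 < δ) :
    ∃ N : ℕ, ∀ d ≥ N, eLpNorm ((fun x => ∑ k ∈ Finset.range d, unitStep a f ε (v.1 + k) x) -
      fun x => ∑ k ∈ Finset.range N, unitStep a f ε (v.1 + k) x) (ENNReal.ofReal q)
        (volume.restrict (cube v.1 v.2)) < δ := by
  have hq0 : 0 < q := by linarith
  obtain ⟨r, hr0, hrδ⟩ : ∃ r : ℝ, 0 < r ∧ ENNReal.ofReal r ^ (1 / q) < δ := by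
    obtain ⟨c, hc0, hcδ⟩ := ENNReal.lt_iff_exists_nnreal_btwn.1 hδ
    refine ⟨(c : ℝ) ^ q, Real.rpow_pos_of_pos (by exact_mod_cast hc0) q, ?_⟩
    rw [← ENNReal.ofReal_rpow_of_nonneg (NNReal.coe_nonneg c) hq0.le, ← ENNReal.rpow_mul, mul_one_div_cancel hq0.ne',
      ENNReal.rpow_one, ENNReal.ofReal_coe_nnreal]
    exact hcδ
  obtain ⟨C₂, hC₂, h₂⟩ := exists_cubeMax_moment_le hq
  set V := volume.real (cube v.1 v.2) with hV
  have hV0 : 0 < V := volume_real_cube_pos _ _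
  set Z := C₂ * cubeMean (fun x => ‖f x‖ ^ q) v with hZ
  have hZ0 : 0 ≤ Z := mul_nonneg hC₂.le (cubeMean_nonneg (fun x => by positivity) v)
  have hP : ∀ d, (childMean (cubeMaxTree f) ^ d) (fun w => cubeMax f w ^ q) (v, 0) ≤ Z :=
    fun d => h₂ f (integrableOn_of_memLp hq hf) (integrableOn_rpow_of_memLp hq hf) d v
  -- Together with `κ` below, this splits the admissible error `r` into two halves; `η` must be
  -- fixed first because `C₁` depends on it.
  set η : ℝ := r / (2 * V * (Z + 1)) with hη
  have hη0 : 0 < η := by positivity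
  obtain ⟨C₁, hC₁, h₁⟩ := exists_walk_tail_le hq n hη0
  set T := fun d => carlesonSum q a f ε d v with hT
  have hTmono : Monotone T := carlesonSum_mono ε v
  have hTbdd : BddAbove (Set.range T) := by
    refine ⟨(8 + 4 * ((2 : ℝ) ^ n) ^ 2) * Z, ?_⟩
    rintro _ ⟨d, rfl⟩
    exact (carlesonSum_le ε hq0.le ha d v).trans (by gcongr; exact hP d)
  have hlim := tendsto_atTop_ciSup hTmono hTbdd
  set κ : ℝ := r / (2 * V * C₁) with hκ
  have hκ0 : 0 < κ := by positivity
  obtain ⟨N, hN⟩ := ((tendsto_order.1 hlim).1 (iSup T - κ) (by linarith)).exists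
  refine ⟨N, fun d hd => lt_of_le_of_lt ?_ hrδ⟩
  have hsub : ((fun x => ∑ k ∈ Finset.range d, unitStep a f ε (v.1 + k) x) -
      fun x => ∑ k ∈ Finset.range N, unitStep a f ε (v.1 + k) x) =
      fun x => ∑ k ∈ Finset.Ico N d, unitStep a f ε (v.1 + k) x := by
    funext x
    rw [Pi.sub_apply, ← Finset.sum_range_add_sum_Ico _ hd, add_sub_cancel_left]
  rw [hsub, eLpNorm_ofReal_eq hq0]
  refine ENNReal.rpow_le_rpow ((h₁ a f ε ha hd v).trans (ENNReal.ofReal_le_ofReal ?_))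
    (by positivity)
  have h5 : T d - T N ≤ κ := by linarith [le_ciSup hTbdd d]
  calc _ ≤ V * (η * Z + C₁ * κ) := by
        gcongr
        exact hP d
    _ = r / 2 * (Z / (Z + 1)) + r / 2 := by rw [hη, hκ]; field_simp
    _ ≤ r / 2 * 1 + r / 2 := by
        gcongr
        rw [div_le_one (by linarith)]; linarith
    _ = r := by ring

end Local

/-! ### Coarse generations, convergence and the Morrey bound. -/

section Global

variable {n : ℕ} {𝕜 : Type*} [RCLike 𝕜] {p q : ℝ}

theorem volume_real_cube_rpow (j : ℤ) (m : Fin n → ℤ) (s : ℝ) :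
    volume.real (cube j m) ^ (-s) = (2 : ℝ) ^ ((j : ℝ) * (n * s)) := by
  rw [volume_real_cube, inv_pow, Real.inv_rpow (by positivity), Real.rpow_neg (by positivity),
    inv_inv, Real.rpow_mul two_pos.le, Real.rpow_intCast, Real.rpow_mul (by positivity),
    Real.rpow_natCast]

/-- Jensen on a single cube: the mean is at most `|Q|^{-1/p}` times the Morrey norm. This is the
source of decay for large cubes. -/
theorem norm_cubeMean_le_morreyNorm (hq : 1 < q) {f : (Fin n → ℝ) → 𝕜} (hf : MemMorrey p q f)
    (v : CubeIndex n) :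
    ‖cubeMean f v‖ ≤ (2 : ℝ) ^ ((v.1 : ℝ) * (n * (1 / p))) * (morreyNorm p q f).toReal := by
  have hq0 : 0 < q := by linarith
  have hL := hf.memLp hq0
  set V := volume.real (cube v.1 v.2) with hV
  have hV0 : 0 < V := volume_real_cube_pos _ _
  set y := cubeMean (fun x => ‖f x‖) v with hy
  have hy0 : 0 ≤ y := cubeMean_norm_nonneg f v
  have h1 : y ^ q ≤ cubeMean (fun x => ‖f x‖ ^ q) v :=
    cubeMean_rpow_le hq.le (fun x => norm_nonneg _) (integrableOn_of_memLp hq hL v).norm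
      (integrableOn_rpow_of_memLp hq hL v)
  have h2 : ENNReal.ofReal (V * y ^ q) ≤ ∫⁻ x in cube v.1 v.2, ‖f x‖ₑ ^ q := by
    rw [← ofReal_volume_mul_cubeMean hq hL v]
    exact ENNReal.ofReal_le_ofReal (by gcongr)
  have h3 := le_morreyNorm (p := p) hq0 f v
  rw [eLpNorm_ofReal_eq hq0] at h3
  have h4 : ENNReal.ofReal (V ^ (1 / p - 1 / q) * (V * y ^ q) ^ (1 / q)) ≤ morreyNorm p q f := by
    refine le_trans ?_ h3
    rw [ENNReal.ofReal_mul (by positivity), ← ENNReal.ofReal_rpow_of_pos hV0,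
      ← ENNReal.ofReal_rpow_of_nonneg (by positivity) (by positivity), hV,
      ofReal_measureReal (volume_cube_ne_top _ _)]
    gcongr
  have h5 := (ENNReal.ofReal_le_iff_le_toReal hf.2.ne).1 h4
  have h6 : V ^ (1 / p - 1 / q) * (V * y ^ q) ^ (1 / q) = V ^ (1 / p) * y := by
    rw [Real.mul_rpow hV0.le (by positivity), ← Real.rpow_mul hy0, mul_one_div_cancel hq0.ne',
      Real.rpow_one, ← mul_assoc, ← Real.rpow_add hV0, sub_add_cancel]
  rw [h6] at h5
  rw [← volume_real_cube_rpow v.1 v.2]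
  refine (norm_cubeMean_le f v).trans ?_
  rw [Real.rpow_neg hV0.le, inv_mul_eq_div, le_div_iff₀ (by positivity), mul_comm]
  exact h5

theorem norm_unitCoeff_le {a : (Fin n → ℝ) → 𝕜} (ha : MemBMO a) (ε : HaarIndex n)
    (v : CubeIndex n) : ‖unitCoeff a ε v‖ ≤ √(8 + 4 * ((2 : ℝ) ^ n) ^ 2) := by
  have h := potential_unitCoeff_le ha ε 1 v
  simp only [potential_succ, potential_zero, map_zero, add_zero] at h
  exact Real.le_sqrt_of_sq_le h

theorem norm_unitStep_le (hq : 1 < q) {a f : (Fin n → ℝ) → 𝕜} (ε : HaarIndex n) (ha : MemBMO a)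
    (hf : MemMorrey p q f) (j : ℤ) (k : ℕ) (x : Fin n → ℝ) :
    ‖unitStep a f ε (j - (k + 1)) x‖ ≤ (√(8 + 4 * ((2 : ℝ) ^ n) ^ 2) *
      (morreyNorm p q f).toReal * 2 ^ ((j : ℝ) * (n * (1 / p))) * 2 ^ (-(n * (1 / p)))) *
      ((2 : ℝ) ^ (-(n * (1 / p)))) ^ k := by
  rw [unitStep, norm_haarStep, norm_mul]
  have h1 := norm_cubeMean_le_morreyNorm hq hf (j - ((k : ℤ) + 1), location (j - (k + 1)) x)
  have h2 := norm_unitCoeff_le ha ε (j - ((k : ℤ) + 1), location (j - (k + 1)) x)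
  refine (mul_le_mul h1 h2 (norm_nonneg _) (by positivity)).trans (le_of_eq ?_)
  have h3 : (2 : ℝ) ^ (((j - ((k : ℤ) + 1) : ℤ) : ℝ) * (n * (1 / p))) =
      2 ^ ((j : ℝ) * (n * (1 / p))) * 2 ^ (-(n * (1 / p))) * ((2 : ℝ) ^ (-(n * (1 / p)))) ^ k := by
    rw [← Real.rpow_natCast, ← Real.rpow_mul two_pos.le, ← Real.rpow_add two_pos,
      ← Real.rpow_add two_pos]
    congr 1; push_cast; ring
  simp only
  rw [h3]
  ring

theorem finite_location_image {K : Set (Fin n → ℝ)} (hK : Bornology.IsBounded K) :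
    (location 0 '' K).Finite := by
  obtain ⟨R, hR⟩ := hK.exists_norm_le
  refine (Set.Finite.pi' fun _ : Fin n => Set.finite_Icc (-⌈R⌉ - 1) ⌈R⌉).subset ?_
  rintro _ ⟨x, hx, rfl⟩ i
  have h1 := abs_le.1 ((norm_le_pi_norm x i).trans (hR x hx))
  have h2 := Int.le_ceil R
  constructor
  · refine Int.le_floor.2 ?_
    rw [zpow_zero, one_mul]; push_cast; linarith [h1.1]
  · refine (Int.floor_le_ceil _).trans (Int.ceil_mono ?_)
    rw [zpow_zero, one_mul]; exact h1.2

theorem tendsto_eLpNorm_of_cubes (hq : 0 < q) {β : Type*} {l : Filter β}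
    {h : β → (Fin n → ℝ) → 𝕜}
    (hh : ∀ m, Tendsto (fun N => eLpNorm (h N) (ENNReal.ofReal q) (volume.restrict (cube 0 m)))
      l (𝓝 0)) {K : Set (Fin n → ℝ)} (hK : Bornology.IsBounded K) :
    Tendsto (fun N => eLpNorm (h N) (ENNReal.ofReal q) (volume.restrict K)) l (𝓝 0) := by
  have hfin := finite_location_image hK
  have := hfin.fintype
  have hsub : K ⊆ ⋃ m : location 0 '' K, cube 0 m.1 := fun x hx =>
    Set.mem_iUnion.2 ⟨⟨_, Set.mem_image_of_mem _ hx⟩, mem_cube_location 0 x⟩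
  have h1 : ∀ m, Tendsto (fun N => ∫⁻ x in cube 0 m, ‖h N x‖ₑ ^ q) l (𝓝 0) := by
    intro m
    have := ((ENNReal.continuous_rpow_const (y := q)).tendsto 0).comp (hh m)
    rw [ENNReal.zero_rpow_of_pos hq] at this
    refine this.congr fun N => ?_
    rw [Function.comp_apply, eLpNorm_ofReal_eq hq, ← ENNReal.rpow_mul,
      one_div_mul_cancel hq.ne', ENNReal.rpow_one]
  have h2 : Tendsto (fun N => ∑ m : location 0 '' K, ∫⁻ x in cube 0 m.1, ‖h N x‖ₑ ^ q) l
      (𝓝 0) := by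
    simpa using tendsto_finsetSum Finset.univ fun m _ => h1 (m : location 0 '' K).1
  have h3 : Tendsto (fun N => ∫⁻ x in K, ‖h N x‖ₑ ^ q) l (𝓝 0) := by
    refine tendsto_of_tendsto_of_tendsto_of_le_of_le tendsto_const_nhds h2
      (fun _ => zero_le) fun N => ?_
    refine (lintegral_mono_set hsub).trans ((lintegral_iUnion_le _ _).trans ?_)
    rw [tsum_fintype]
  have h4 := ((ENNReal.continuous_rpow_const (y := 1 / q)).tendsto 0).comp h3
  rw [ENNReal.zero_rpow_of_pos (by positivity)] at h4
  refine h4.congr fun N => ?_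
  rw [Function.comp_apply, eLpNorm_ofReal_eq hq]

/-- Negative generations converge uniformly, with geometric ratio `2 ^ (-n / p)`; the others
converge in `L^q` on each cube of generation `0`, and the limits are glued. -/
theorem exists_hasSumLqLoc_unitStep (hn : 0 < n) (hq : 1 < q) (hp : 0 < p)
    {a f : (Fin n → ℝ) → 𝕜} (ε : HaarIndex n) (ha : MemBMO a) (hf : MemMorrey p q f) :
    ∃ g : (Fin n → ℝ) → 𝕜, AEStronglyMeasurable g volume ∧
      HasSumLqLoc q (unitStep a f ε) g := by
  have hq0 : 0 < q := by linarith
  have hq1 : 1 ≤ ENNReal.ofReal q := by simpa using hq.le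
  have hL := hf.memLp hq0
  choose G hGm hG using fun m : Fin n → ℤ => exists_tendsto_eLpNorm_of_cauchy hq1
    (fun d => ⟨(stronglyMeasurable_sum_unitStep a f ε (Finset.range d)
      (fun k => (0 : ℤ) + k)).aestronglyMeasurable, (by
        obtain ⟨C, hC⟩ := exists_eLpNorm_sum_unitStep_le hq n
        exact (hC a f ε ha hL d (0, m)).trans_lt
          (ENNReal.mul_lt_top ENNReal.coe_lt_top (hL (0, m)).2))⟩)
    (fun δ hδ => cauchy_sum_unitStep hq ε ha hL (0, m) hδ)
  set ρ : ℝ := (2 : ℝ) ^ (-(n * (1 / p))) with hρ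
  have hρ0 : 0 < ρ := by positivity
  have hρ1 : ρ < 1 := Real.rpow_lt_one_of_one_lt_of_neg one_lt_two (by
    have : (0 : ℝ) < n := by exact_mod_cast hn
    simp only [Left.neg_neg_iff]; positivity)
  set c : ℝ := √(8 + 4 * ((2 : ℝ) ^ n) ^ 2) *
      (morreyNorm p q f).toReal * 2 ^ (((0 : ℤ) : ℝ) * (n * (1 / p))) * ρ with hc
  have hbd : ∀ (k : ℕ) x, ‖unitStep a f ε (0 - (k + 1)) x‖ ≤ c * ρ ^ k := fun k x =>
    norm_unitStep_le hq ε ha hf 0 k x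
  have hsum : ∀ x, HasSum (fun k : ℕ => unitStep a f ε (0 - (k + 1)) x)
      (∑' k : ℕ, unitStep a f ε (0 - (k + 1)) x) := fun x =>
    (Summable.of_norm_bounded ((summable_geometric_of_lt_one hρ0.le hρ1).mul_left c)
      fun k => hbd k x).hasSum
  set gneg : (Fin n → ℝ) → 𝕜 := fun x => ∑' k : ℕ, unitStep a f ε (0 - (k + 1)) x with hgneg
  set gpos : (Fin n → ℝ) → 𝕜 := fun x => G (location 0 x) x with hgpos
  have hneg_meas : StronglyMeasurable gneg :=
    stronglyMeasurable_of_tendsto atTop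
      (fun d => stronglyMeasurable_sum_unitStep a f ε (Finset.range d) fun k => 0 - ((k : ℤ) + 1))
      (tendsto_pi_nhds.2 fun x => (hsum x).tendsto_sum_nat)
  have hpos_eq : ∀ m, Set.EqOn gpos (G m) (cube 0 m) := fun m x hx => by
    simp only [hgpos, mem_cube_iff.1 hx]
  have hpos_ae : ∀ m, gpos =ᵐ[volume.restrict (cube 0 m)] G m := fun m =>
    (ae_restrict_iff' (measurableSet_cube _ _)).2 (Eventually.of_forall (hpos_eq m))
  have hpos_meas : AEStronglyMeasurable gpos volume := by
    have huniv : (⋃ m : Fin n → ℤ, cube 0 m) = Set.univ :=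
      Set.eq_univ_of_forall fun x => Set.mem_iUnion.2 ⟨_, mem_cube_location 0 x⟩
    rw [← Measure.restrict_univ (μ := volume), ← huniv, aestronglyMeasurable_iUnion_iff]
    exact fun m => (hGm m).1.congr (hpos_ae m).symm
  refine ⟨fun x => gneg x + gpos x, hneg_meas.aestronglyMeasurable.add hpos_meas,
    fun K hK => tendsto_eLpNorm_of_cubes hq0 (fun m => ?_) hK.isBounded⟩
  have hT1 : Tendsto (fun N : ℕ × ℕ => volume (cube (0 : ℤ) m) ^ (ENNReal.ofReal q).toReal⁻¹ *
      ENNReal.ofReal (c * ρ ^ N.1 / (1 - ρ))) atTop (𝓝 0) := by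
    have h1 : Tendsto (fun k : ℕ => c * ρ ^ k / (1 - ρ)) atTop (𝓝 0) := by
      simpa using ((tendsto_pow_atTop_nhds_zero_of_lt_one hρ0.le hρ1).const_mul c).div_const (1 - ρ)
    have h2 := ENNReal.tendsto_ofReal h1
    rw [ENNReal.ofReal_zero] at h2
    have h3 := ENNReal.Tendsto.const_mul (a := volume (cube (0 : ℤ) m) ^
      (ENNReal.ofReal q).toReal⁻¹) h2 (Or.inr (ENNReal.rpow_ne_top_of_nonneg
        (inv_nonneg.2 ENNReal.toReal_nonneg) (volume_cube_ne_top _ _)))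
    rw [mul_zero] at h3
    rw [← prod_atTop_atTop_eq]
    exact h3.comp tendsto_fst
  have hT2 : Tendsto (fun N : ℕ × ℕ => eLpNorm ((fun x => ∑ k ∈ Finset.range (N.2 + 1),
      unitStep a f ε (0 + k) x) - G m) (ENNReal.ofReal q) (volume.restrict (cube 0 m)))
      atTop (𝓝 0) := by
    rw [← prod_atTop_atTop_eq]
    exact ((hG m).comp (tendsto_add_atTop_nat 1)).comp tendsto_snd
  have hT := hT1.add hT2
  rw [add_zero] at hT
  refine tendsto_of_tendsto_of_tendsto_of_le_of_le tendsto_const_nhds hT (fun _ => zero_le)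
    fun N => ?_
  set s₁ : (Fin n → ℝ) → 𝕜 := fun x =>
    ∑ k ∈ Finset.range N.1, unitStep a f ε (0 - (k + 1)) x - gneg x with hs₁
  set s₂ : (Fin n → ℝ) → 𝕜 := (fun x =>
    ∑ k ∈ Finset.range (N.2 + 1), unitStep a f ε (0 + k) x) - G m with hs₂
  have hsplit : (fun x => (∑ j ∈ Finset.Icc (-(N.1 : ℤ)) (N.2 : ℤ), unitStep a f ε j x) -
      (gneg x + gpos x)) =ᵐ[volume.restrict (cube 0 m)] s₁ + s₂ := by
    filter_upwards [hpos_ae m] with x hx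
    have hI : Finset.Icc (-(N.1 : ℤ)) (N.2 : ℤ) = Finset.Ico (0 - (N.1 : ℤ)) (0 + (N.2 + 1 : ℕ)) := by
      ext i; simp only [Finset.mem_Icc, Finset.mem_Ico]; omega
    rw [hI, sum_Ico_int_eq, hx]
    simp only [hs₁, hs₂, Pi.add_apply, Pi.sub_apply]
    abel
  rw [eLpNorm_congr_ae hsplit]
  refine (eLpNorm_add_le ?_ ?_ hq1).trans (add_le_add ?_ le_rfl)
  · exact ((stronglyMeasurable_sum_unitStep a f ε (Finset.range N.1)
      fun k => 0 - ((k : ℤ) + 1)).sub hneg_meas).aestronglyMeasurable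
  · exact (stronglyMeasurable_sum_unitStep a f ε (Finset.range (N.2 + 1))
      fun k => 0 + (k : ℤ)).aestronglyMeasurable.sub (hGm m).1
  · refine (eLpNorm_le_of_ae_bound (C := c * ρ ^ N.1 / (1 - ρ))
      (Eventually.of_forall fun x => ?_)).trans (by rw [Measure.restrict_apply_univ])
    exact norm_sub_le_of_geometric_bound_of_hasSum hρ1 (fun k => hbd k x) (hsum x) N.1

/-- The series is split at the generation of the test cube, so the limit `g` is arbitrary and is
reached only through its partial sums. -/
theorem exists_morreyNorm_le_of_hasSumLqLoc (hn : 0 < n) (hq : 1 < q) (hp : 0 < p) :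
    ∃ C : ℝ≥0, ∀ {𝕜 : Type*} [RCLike 𝕜] (a f g : (Fin n → ℝ) → 𝕜) (ε : HaarIndex n),
      MemBMO a → MemMorrey p q f → AEStronglyMeasurable g volume →
      HasSumLqLoc q (unitStep a f ε) g → morreyNorm p q g ≤ C * morreyNorm p q f := by
  have hq0 : 0 < q := by linarith
  have hq1 : 1 ≤ ENNReal.ofReal q := by simpa using hq.le
  obtain ⟨C, hC⟩ := exists_eLpNorm_sum_unitStep_le hq n
  set ρ : ℝ := (2 : ℝ) ^ (-(n * (1 / p))) with hρ
  have hρ0 : 0 < ρ := by positivity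
  have hρ1 : ρ < 1 := Real.rpow_lt_one_of_one_lt_of_neg one_lt_two (by
    have : (0 : ℝ) < n := by exact_mod_cast hn
    simp only [Left.neg_neg_iff]; positivity)
  set κ : ℝ := √(8 + 4 * ((2 : ℝ) ^ n) ^ 2) * ρ * (1 - ρ)⁻¹ with hκ
  have hκ0 : 0 ≤ κ := mul_nonneg (by positivity) (inv_nonneg.2 (by linarith))
  refine ⟨κ.toNNReal + C, fun {𝕜} _ a f g ε ha hf hg hsum => ?_⟩
  have hL := hf.memLp hq0
  rw [morreyNorm_eq hq0]
  refine iSup₂_le fun j m => ?_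
  set μ := volume.restrict (cube j m) with hμ
  set W := volume (cube j m) ^ (1 / p - 1 / q) with hW
  set X : ℝ := 2 ^ ((j : ℝ) * (n * (1 / p))) with hX
  set F := (morreyNorm p q f).toReal with hF
  set b : ℝ := κ * F * X with hb
  have hlow : ∀ (d : ℕ) x, ‖∑ k ∈ Finset.range d, unitStep a f ε (j - (k + 1)) x‖ ≤ b := by
    intro d x
    refine (norm_sum_le_of_le _ fun k _ => norm_unitStep_le hq ε ha hf j k x).trans ?_
    rw [← Finset.mul_sum, hb, hκ]
    have h1 : ∑ k ∈ Finset.range d, ρ ^ k ≤ (1 - ρ)⁻¹ := by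
      rw [← tsum_geometric_of_lt_one hρ0.le hρ1]
      exact (summable_geometric_of_lt_one hρ0.le hρ1).sum_le_tsum _ fun k _ => by positivity
    calc _ ≤ (√(8 + 4 * ((2 : ℝ) ^ n) ^ 2) * F * X * ρ) * (1 - ρ)⁻¹ := by gcongr
      _ = _ := by ring
  -- The condition on `N` puts `j` inside `[-N, N]`, so that the sum really splits at `j`.
  have hbd : ∀ N : ℕ, j.natAbs ≤ N →
      eLpNorm (fun x => ∑ i ∈ Finset.Icc (-(N : ℤ)) (N : ℤ), unitStep a f ε i x)
        (ENNReal.ofReal q) μ ≤ volume (cube j m) ^ (1 / q) * ENNReal.ofReal b +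
          C * eLpNorm f (ENNReal.ofReal q) μ := by
    intro N hN
    have hI : Finset.Icc (-(N : ℤ)) (N : ℤ) =
        Finset.Ico (j - ((N + j).toNat : ℕ)) (j + ((N + 1 - j).toNat : ℕ)) := by
      ext i; simp only [Finset.mem_Icc, Finset.mem_Ico]; omega
    simp only [hI, sum_Ico_int_eq]
    refine (eLpNorm_add_le
      (f := fun x => ∑ k ∈ Finset.range (N + j).toNat, unitStep a f ε (j - (k + 1)) x)
      (g := fun x => ∑ k ∈ Finset.range (N + 1 - j).toNat, unitStep a f ε (j + k) x)
      (stronglyMeasurable_sum_unitStep _ _ _ _ _).aestronglyMeasurable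
      (stronglyMeasurable_sum_unitStep _ _ _ _ _).aestronglyMeasurable hq1).trans
      (add_le_add ?_ (hC a f ε ha hL _ (j, m)))
    refine (eLpNorm_le_of_ae_bound (Eventually.of_forall fun x => hlow _ x)).trans ?_
    rw [hμ, Measure.restrict_apply_univ, ENNReal.toReal_ofReal hq0.le, one_div]
  have hconv : Tendsto (fun N : ℕ => eLpNorm (fun x =>
      (∑ i ∈ Finset.Icc (-(N : ℤ)) (N : ℤ), unitStep a f ε i x) - g x) (ENNReal.ofReal q) μ)
      atTop (𝓝 0) := by
    have h1 := (hsum _ (isBounded_cube j m).isCompact_closure).comp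
      (tendsto_atTop_diagonal (α := ℕ))
    refine tendsto_of_tendsto_of_tendsto_of_le_of_le tendsto_const_nhds h1 (fun _ => zero_le)
      fun N => ?_
    exact eLpNorm_mono_measure _ (Measure.restrict_mono subset_closure le_rfl)
  have hgle : eLpNorm g (ENNReal.ofReal q) μ ≤ volume (cube j m) ^ (1 / q) * ENNReal.ofReal b +
          C * eLpNorm f (ENNReal.ofReal q) μ := by
    have h2 := hconv.add_const (volume (cube j m) ^ (1 / q) * ENNReal.ofReal b +
          C * eLpNorm f (ENNReal.ofReal q) μ)
    rw [zero_add] at h2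
    refine ge_of_tendsto h2 ((eventually_ge_atTop j.natAbs).mono fun N hN => ?_)
    have hS := (stronglyMeasurable_sum_unitStep a f ε (Finset.Icc (-(N : ℤ)) (N : ℤ))
      fun i => i).aestronglyMeasurable (μ := μ)
    have e : g = (fun x => ∑ i ∈ Finset.Icc (-(N : ℤ)) (N : ℤ), unitStep a f ε i x) -
        fun x => (∑ i ∈ Finset.Icc (-(N : ℤ)) (N : ℤ), unitStep a f ε i x) - g x := by
      funext x; simp
    conv_lhs => rw [e]
    refine (eLpNorm_sub_le hS (hS.sub hg.restrict) hq1).trans ?_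
    rw [add_comm]
    exact add_le_add le_rfl (hbd N hN)
  have hfin := le_morreyNorm (p := p) hq0 f (j, m)
  have hWV : W * volume (cube j m) ^ (1 / q) = volume (cube j m) ^ (1 / p) := by
    rw [hW, ← ENNReal.rpow_add _ _ (volume_cube_ne_zero _ _) (volume_cube_ne_top _ _),
      sub_add_cancel]
  -- Scale invariance: `X` is `|Q|^{-1/p}`, so the size of the cube cancels.
  have hVX : volume (cube j m) ^ (1 / p) * ENNReal.ofReal b = κ.toNNReal * morreyNorm p q f := by
    have hV0 := volume_real_cube_pos j m
    have h1 : volume.real (cube j m) ^ (1 / p) * X = 1 := by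
      rw [hX, ← volume_real_cube_rpow j m, ← Real.rpow_add hV0, add_neg_cancel, Real.rpow_zero]
    rw [← ofReal_measureReal (volume_cube_ne_top j m), ENNReal.ofReal_rpow_of_pos hV0,
      ← ENNReal.ofReal_mul (by positivity), hb,
      show volume.real (cube j m) ^ (1 / p) * (κ * F * X) =
        κ * F * (volume.real (cube j m) ^ (1 / p) * X) by ring, h1, mul_one,
      ENNReal.ofReal_mul hκ0, hF, ENNReal.ofReal_toReal hf.2.ne]
    rfl
  calc W * eLpNorm g (ENNReal.ofReal q) μ
      ≤ W * (volume (cube j m) ^ (1 / q) * ENNReal.ofReal b +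
          C * eLpNorm f (ENNReal.ofReal q) μ) := by gcongr
    _ = κ.toNNReal * morreyNorm p q f + C * (W * eLpNorm f (ENNReal.ofReal q) μ) := by
        rw [mul_add, ← mul_assoc, hWV, hVX, mul_left_comm]
    _ ≤ κ.toNNReal * morreyNorm p q f + C * morreyNorm p q f := by gcongr
    _ = _ := by rw [ENNReal.coe_add, add_mul]

theorem paraproductLevel_eq_smul_unitStep {a : (Fin n → ℝ) → 𝕜} (ha : MemBMO a)
    (f : (Fin n → ℝ) → 𝕜) (ε : HaarIndex n) (j : ℤ) (x : Fin n → ℝ) :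
    paraproductLevel a f ε j x = (bmoNorm a).toReal • unitStep a f ε j x := by
  rw [paraproductLevel_eq_haarStep ha.1, unitStep, haarStep, haarStep, ← smul_unitCoeff ha,
    smul_comm, mul_smul_comm]

theorem HasSumLqLoc.const_smul {u : ℤ → (Fin n → ℝ) → 𝕜} {g : (Fin n → ℝ) → 𝕜}
    (h : HasSumLqLoc q u g) (c : ℝ) : HasSumLqLoc q (fun j x => c • u j x) (c • g) := by
  intro K hK
  have h1 := ENNReal.Tendsto.const_mul (a := ‖c‖ₑ) (h K hK) (Or.inr enorm_ne_top)
  rw [mul_zero] at h1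
  refine h1.congr fun N => ?_
  rw [← eLpNorm_const_smul]
  congr 1
  funext x
  simp only [Pi.smul_apply, smul_sub, Finset.smul_sum]

end Global

end DyadicMorrey

end

/-! ### Assembly of the theorem. -/

theorem theorem2 {𝕜 : Type*} [RCLike 𝕜] (n : ℕ) (p q : ℝ) (hq : 1 < q) (hqp : q ≤ p) :
    ∃ C : ℝ≥0, ∀ a : (Fin n → ℝ) → 𝕜, DyadicMorrey.MemBMO a →
      ∀ f : (Fin n → ℝ) → 𝕜, DyadicMorrey.MemMorrey p q f →
        ∃ g : DyadicMorrey.HaarIndex n → (Fin n → ℝ) → 𝕜,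
          (∀ ε, DyadicMorrey.MemMorrey p q (g ε)) ∧
          (∀ ε, DyadicMorrey.HasSumLqLoc q (DyadicMorrey.paraproductLevel a f ε) (g ε)) ∧
          ∑ ε, DyadicMorrey.morreyNorm p q (g ε)
            ≤ (C : ℝ≥0∞) * DyadicMorrey.bmoNorm a * DyadicMorrey.morreyNorm p q f := by
  -- In dimension zero there are no Haar indices, and the ratio `2 ^ (-n / p)` would not be less
  -- than `1`.
  rcases n.eq_zero_or_pos with rfl | hn
  · have : IsEmpty (DyadicMorrey.HaarIndex 0) := ⟨fun ε => ε.2 (Subsingleton.elim _ _)⟩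
    exact ⟨0, fun a _ f _ => ⟨fun _ => 0, fun ε => isEmptyElim ε, fun ε => isEmptyElim ε, by simp⟩⟩
  have hq0 : 0 < q := by linarith
  have hp : 0 < p := by linarith
  obtain ⟨C, hC⟩ := DyadicMorrey.exists_morreyNorm_le_of_hasSumLqLoc hn hq hp
  refine ⟨Fintype.card (DyadicMorrey.HaarIndex n) * C, fun a ha f hf => ?_⟩
  choose g hgm hg using fun ε => DyadicMorrey.exists_hasSumLqLoc_unitStep hn hq hp ε ha hf
  set B : ℝ := (DyadicMorrey.bmoNorm a).toReal with hB
  have hBe : ‖B‖ₑ = DyadicMorrey.bmoNorm a := by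
    rw [Real.enorm_of_nonneg ENNReal.toReal_nonneg, ENNReal.ofReal_toReal ha.2.ne]
  have hle : ∀ ε, DyadicMorrey.morreyNorm p q (B • g ε) ≤
      DyadicMorrey.bmoNorm a * (C * DyadicMorrey.morreyNorm p q f) := fun ε => by
    refine (DyadicMorrey.morreyNorm_const_smul hq0 B (g ε)).trans ?_
    rw [hBe]
    gcongr
    exact hC a f (g ε) ε ha hf (hgm ε) (hg ε)
  -- The normalized sums are scaled back by the `BMO` norm, which makes the bound linear in it.
  refine ⟨fun ε => B • g ε, fun ε => ⟨(hgm ε).const_smul B, (hle ε).trans_lt ?_⟩, fun ε => ?_, ?_⟩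
  · exact ENNReal.mul_lt_top ha.2 (ENNReal.mul_lt_top ENNReal.coe_lt_top hf.2)
  · have h := (hg ε).const_smul B
    have e : DyadicMorrey.paraproductLevel a f ε =
        fun j x => B • DyadicMorrey.unitStep a f ε j x := by
      funext j x
      exact DyadicMorrey.paraproductLevel_eq_smul_unitStep ha f ε j x
    rw [e]
    exact h
  · refine (Finset.sum_le_sum fun ε _ => hle ε).trans (le_of_eq ?_)
    rw [Finset.sum_const, Finset.card_univ, nsmul_eq_mul]
    push_cast
    ring
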